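/- Notation. Let $\mathbb{C}_Y$ be $\mathbb{C}$ with $\alpha\in U(1)$ acting as $\alpha^{3Y}$. Let $G_{SM}=U(1)\times SU(2)\times SU(3)$, and let $F$ be its representation $$F=(\mathbb{C}_{-1}\otimes\mathbb{C}^2\otimes\mathbb{C})\oplus(\mathbb{C}_{1/3}\otimes\mathbb{C}^2\otimes\mathbb{C}^3)\oplus(\mathbb{C}_0\otimes\mathbb{C}\otimes\mathbb{C})\oplus(\mathbb{C}_{-2}\otimes\mathbb{C}\otimes\mathbb{C})\oplus(\mathbb{C}_{4/3}\otimes\mathbb{C}\otimes\mathbb{C}^3)\oplus(\mathbb{C}_{-2/3}\otimes\mathbb{C}\otimes\mathbb{C}^3),$$ with standard bases named, in this order, $(\nu_L,e^-_L)$, $(u_L^c,d_L^c)$, $\nu_R$, $e^-_R$, $u_R^c$, $d_R^c$, where $c\in\{r,g,b\}$. The Standard Model representation is $F\oplus F^*$. In $F^*$, using the dual basis (marked by $*$), put $$e^+_R=(e^-_L)^*,\ \ \bar\nu_R=-(\nu_L)^*,\ \ \bar d_R^{\bar c}=(d_L^c)^*,\ \ \bar u_R^{\bar c}=-(u_L^c)^*,\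 \ e^+_L=(e^-_R)^*,\ \ \bar\nu_L=(\nu_R)^*,\ \ \bar d_L^{\bar c}=(d_R^c)^*,\ \ \bar u_L^{\bar c}=(u_R^c)^*.$$ Let $V=\big((\mathbb{C}^2\otimes\mathbb{C})\oplus(\mathbb{C}\otimes\mathbb{C}^2)\big)\otimes(\mathbb{C}^4\oplus\mathbb{C}^{4*})$ be the Pati--Salam representation of $SU(2)\times SU(2)\times SU(4)$. Its first factor has basis $u_L,d_L$ (of $\mathbb{C}^2\otimes\mathbb{C}$) and $u_R,d_R$ (of $\mathbb{C}\otimes\mathbb{C}^2$); $\mathbb{C}^4$ has basis $r,g,b,w$, with dual basis $\bar r,\bar g,\bar b,\bar w$. Let $$\beta:G_{SM}\to SU(2)\times SU(2)\times SU(4),\qquad \beta(\alpha,g,h)=\left(g,\ \begin{pmatrix}\alpha^3&0\\0&\alpha^{-3}\end{pmatrix},\ \begin{pmatrix}\alpha h&0\\0&\alpha^{-3}\end{pmatrix}\right),$$ and let $\ell:F\oplus F^*\to V$ be the unitary operator with $$\nu_{S}\mapsto u_{S}\otimes w,\quad e^-_{S}\mapsto d_{S}\otimes w,\quad u^c_{S}\mapsto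 u_{S}\otimes c,\quad d^c_{S}\mapsto d_{S}\otimes c\qquad(S\in\{L,R\}),$$ $$e^+_R\mapsto u_L\otimes\bar w,\quad \bar\nu_R\mapsto d_L\otimes\bar w,\quad \bar d^{\bar c}_R\mapsto u_L\otimes\bar c,\quad \bar u^{\bar c}_R\mapsto d_L\otimes\bar c,$$ $$e^+_L\mapsto u_R\otimes\bar w,\quad \bar\nu_L\mapsto d_R\otimes\bar w,\quad \bar d^{\bar c}_L\mapsto u_R\otimes\bar c,\quad \bar u^{\bar c}_L\mapsto d_R\otimes\bar c.$$ Give $\Lambda\mathbb{C}^n$ the inner product in which the wedge products of standard basis vectors are orthonormal. Let $a_j^*$ be the operator of wedging with $e_j$ on the left and $a_j$ its adjoint. Realize $\mathrm{Spin}(2n)$ in the real Clifford algebra of $\mathbb{R}^{2n}$ with relations $vw+wv=-2\langle v,w\rangle$ as the group generated by products of pairs of unit vectors. Its Dirac spinor representation on $\Lambda\mathbb{C}^n$ is obtained by sending the standard basis of $\mathbb{R}^{2n}$, in any fixed order, to the operators $i(a_j+a_j^*)$ and $a_j-a_j^*$, $1\le j\le n$. For $\varepsilon\in\{1,-1\}$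 let $k_\varepsilon:V\to\Lambda\mathbb{C}^2\otimes\Lambda\mathbb{C}^3$ be the tensor product of the unitary operators $(\mathbb{C}^2\otimes\mathbb{C})\oplus(\mathbb{C}\otimes\mathbb{C}^2)\to\Lambda\mathbb{C}^2$ and $\mathbb{C}^4\oplus\mathbb{C}^{4*}\to\Lambda\mathbb{C}^3$ given by $$u_L\mapsto u,\quad d_L\mapsto d,\quad u_R\mapsto u\wedge d,\quad d_R\mapsto 1,$$ $$r\mapsto r,\ \ g\mapsto g,\ \ b\mapsto b,\ \ w\mapsto r\wedge g\wedge b,\qquad \bar r\mapsto g\wedge b,\ \ \bar g\mapsto b\wedge r,\ \ \bar b\mapsto r\wedge g,\ \ \bar w\mapsto\varepsilon,$$ where $u,d$ and $r,g,b$ also denote the standard bases of $\mathbb{C}^2$ and $\mathbb{C}^3$. The specific choice of $k$ is $k=k_1$. Theorem. The representations of $G_{SM}$ on $F\oplus F^*$ and of $SU(2)\times SU(2)\times SU(4)$ on $V$, and the tensor product of the Dirac spinor representations of $\mathrm{Spin}(4)\times\mathrm{Spin}(6)$ on $\Lambda\mathbb{C}^2\otimes\Lambda\mathbb{C}^3$,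 are unitary. There is exactly one isomorphism of Lie groups $$\alpha:SU(2)\times SU(2)\times SU(4)\to\mathrm{Spin}(4)\times\mathrm{Spin}(6)$$ such that the above operators $\mathbb{C}^2\otimes\mathbb{C}\to\Lambda^{\mathrm{odd}}\mathbb{C}^2$, $\mathbb{C}\otimes\mathbb{C}^2\to\Lambda^{\mathrm{ev}}\mathbb{C}^2$ and $\mathbb{C}^4\to\Lambda^{\mathrm{odd}}\mathbb{C}^3$ intertwine the given representations with the restrictions, along the two components of $\alpha$, of the Dirac spinor representations. For this $\alpha$, $k_{-1}$ intertwines the Pati--Salam representation with the pullback along $\alpha$ of the tensor product of Dirac spinor representations. Moreover, taking $\theta=\alpha\beta$, which is a continuous homomorphism, and $h=k\ell$, the following square commutes: $$\begin{array}{ccc} G_{SM}&\xrightarrow{\ \theta\ }&\mathrm{Spin}(4)\times\mathrm{Spin}(6)\\ \downarrow&&\downarrow\\ U(F\oplus F^*)&\xrightarrow{U(h)}&U(\Lambda\mathbb{C}^2\otimes\Lambda\mathbb{C}^3)\end{array}$$ Here the left arrow is the Standard Model representation, the right one is the tensor product of Dirac spinor representations, and $U(h)(T)=hTh^{-1}$.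 The same holds with $k_{-1}$ in place of $k=k_1$. -/

import Mathlib

open scoped TensorProduct InnerProductSpace

noncomputable section

namespace PatiSalam

/-! ## Generalities -/

/-- The representation on `ℂ^I` given by a multiplicative family of matrices. -/
def matrixRep {G I : Type*} [Group G] [Fintype I] [DecidableEq I] (ρ : G →* Matrix I I ℂ) :
    Representation ℂ G (EuclideanSpace ℂ I) :=
  ((Matrix.toLpLinAlgEquiv 2 : Matrix I I ℂ ≃ₐ[ℂ] Module.End ℂ (EuclideanSpace ℂ I)) :
    Matrix I I ℂ →* Module.End ℂ (EuclideanSpace ℂ I)).comp ρ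

/-- Direct sum of a matrix representation `V` and its dual `V*`, the dual being written in the
dual basis: `x` acts on `V*` by `f ↦ f ∘ ρ(x⁻¹)`, which has matrix `(ρ(x⁻¹))ᵀ`. -/
def withDual {G I : Type*} [Group G] [Fintype I] [DecidableEq I] (ρ : G →* Matrix I I ℂ) :
    G →* Matrix (I ⊕ I) (I ⊕ I) ℂ where
  toFun x := Matrix.fromBlocks (ρ x) 0 0 (ρ x⁻¹).transpose
  map_one' := by simp
  map_mul' x y := by simp [Matrix.fromBlocks_multiply, Matrix.transpose_mul]

/-- An orthonormal family of `dim V` vectors gives a unitary map `ℂ^I ≃ V` sending the standard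
basis to that family. -/
def unitaryOfFamily {I V : Type*} [Fintype I] [DecidableEq I] [NormedAddCommGroup V]
    [InnerProductSpace ℂ V] [FiniteDimensional ℂ V] (v : I → V) (hv : Orthonormal ℂ v)
    (hc : Fintype.card I = Module.finrank ℂ V) : EuclideanSpace ℂ I ≃ₗᵢ[ℂ] V :=
  (OrthonormalBasis.mk hv
    (hv.linearIndependent.span_eq_top_of_card_eq_finrank' hc).ge).repr.symm

theorem unitaryOfFamily_single {I V : Type*} [Fintype I] [DecidableEq I] [NormedAddCommGroup V]
    [InnerProductSpace ℂ V] [FiniteDimensional ℂ V] (v : I → V) (hv : Orthonormal ℂ v)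
    (hc : Fintype.card I = Module.finrank ℂ V) (i : I) :
    unitaryOfFamily v hv hc (EuclideanSpace.single i 1) = v i := by
  simp [unitaryOfFamily]

theorem orthonormal_of_signed {I J V : Type*} [NormedAddCommGroup V]
    [InnerProductSpace ℂ V] [Fintype J] (b : OrthonormalBasis J ℂ V) (σ : I → J)
    (hσ : Function.Injective σ) (ε : I → ℤˣ) {v : I → V}
    (h : ∀ i, v i = ((ε i : ℤ) : ℂ) • b (σ i)) : Orthonormal ℂ v := by
  classical
  rw [orthonormal_iff_ite]
  intro i j
  rw [h, h, inner_smul_left, inner_smul_right, orthonormal_iff_ite.mp b.orthonormal]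
  by_cases hij : i = j
  · subst hij
    rcases Int.units_eq_one_or (ε i) with e | e <;> simp [e]
  · simp [hij, hσ.ne hij]

/-! ## The exterior algebra of `ℂⁿ` as a Hilbert space -/

/-- The exterior algebra `Λ ℂⁿ`. -/
abbrev ExtAlg (n : ℕ) : Type := ExteriorAlgebra ℂ (EuclideanSpace ℂ (Fin n))

/-- The standard basis vector `e_j` of `ℂⁿ`, as an element of `Λ ℂⁿ`. -/
def ext1 {n : ℕ} (j : Fin n) : ExtAlg n :=
  ExteriorAlgebra.ι ℂ (EuclideanSpace.single j (1 : ℂ))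

/-- The induced basis `e_{i₁} ∧ ⋯ ∧ e_{i_p}`, `i₁ < ⋯ < i_p`, of `Λ ℂⁿ`. -/
def extBasis (n : ℕ) : Module.Basis (Finset (Fin n)) ℂ (ExtAlg n) :=
  (EuclideanSpace.basisFun (Fin n) ℂ).toBasis.ExteriorAlgebra

/-- The inner product on `Λ ℂⁿ` for which the induced basis is orthonormal. -/
abbrev extCore (n : ℕ) : InnerProductSpace.Core ℂ (ExtAlg n) where
  inner x y := ∑ s, (starRingEnd ℂ) ((extBasis n).repr x s) * (extBasis n).repr y s
  conj_inner_symm x y := by simp [mul_comm]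
  re_inner_nonneg x := by
    rw [map_sum]
    refine Finset.sum_nonneg fun s _ => ?_
    rw [mul_comm, Complex.mul_conj]
    exact Complex.normSq_nonneg _
  add_left x y z := by simp [add_mul, Finset.sum_add_distrib]
  smul_left x y r := by simp [Finset.mul_sum, mul_assoc]
  definite x h := by
    apply (extBasis n).ext_elem
    intro s
    have h' : ∑ s, Complex.normSq ((extBasis n).repr x s) = 0 := by
      have : ((∑ s, Complex.normSq ((extBasis n).repr x s) : ℝ) : ℂ) = 0 := by
        rw [← h]
        push_cast
        exact Finset.sum_congr rfl fun s _ => by rw [mul_comm, Complex.mul_conj]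
      exact_mod_cast this
    have := (Finset.sum_eq_zero_iff_of_nonneg fun s _ => Complex.normSq_nonneg _).mp h' s
      (Finset.mem_univ s)
    simpa using this

instance extNormedAddCommGroup (n : ℕ) : NormedAddCommGroup (ExtAlg n) :=
  (extCore n).toNormedAddCommGroup

instance extInnerProductSpace (n : ℕ) : InnerProductSpace ℂ (ExtAlg n) :=
  InnerProductSpace.ofCore (extCore n).toCore

instance extFinite (n : ℕ) : FiniteDimensional ℂ (ExtAlg n) := (extBasis n).finiteDimensional_of_finite

theorem ext_inner_def {n : ℕ} (x y : ExtAlg n) :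
    ⟪x, y⟫_ℂ = ∑ s, (starRingEnd ℂ) ((extBasis n).repr x s) * (extBasis n).repr y s := rfl

/-- The induced basis of `Λ ℂⁿ`, as an orthonormal basis. -/
def extONB (n : ℕ) : OrthonormalBasis (Finset (Fin n)) ℂ (ExtAlg n) :=
  (extBasis n).toOrthonormalBasis <| by
    rw [orthonormal_iff_ite]
    intro s t
    simp [ext_inner_def, Finsupp.single_apply]

/-! ## The Dirac spinor representation -/

/-- The creation operator `ψ ↦ e_j ∧ ψ`. -/
def creation {n : ℕ} (j : Fin n) : Module.End ℂ (ExtAlg n) := LinearMap.mulLeft ℂ (ext1 j)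

/-- The `j`-th coordinate function on `ℂⁿ`. -/
def coordFn {n : ℕ} (j : Fin n) : Module.Dual ℂ (EuclideanSpace ℂ (Fin n)) :=
  (EuclideanSpace.proj j : EuclideanSpace ℂ (Fin n) →L[ℂ] ℂ).toLinearMap

/-- The annihilation operator: contraction with the `j`-th coordinate function. It is the
antiderivation with `e_k ↦ δ_{jk}`, so it deletes `e_j` from a wedge product of basis vectors,
with the appropriate sign. -/
def annihilation {n : ℕ} (j : Fin n) : Module.End ℂ (ExtAlg n) :=
  CliffordAlgebra.contractLeft (coordFn j)

/-- The operators `φ_j = i (a_j + a_j*)` and `π_j = a_j - a_j*`. -/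
def gammaOp {n : ℕ} : Fin n ⊕ Fin n → Module.End ℂ (ExtAlg n)
  | .inl j => Complex.I • (annihilation j + creation j)
  | .inr j => annihilation j - creation j

/-- The quadratic form `v ↦ -⟨v, v⟩` on `ℝᵐ`; its Clifford algebra has the relations
`v w + w v = -2 ⟨v, w⟩`. -/
def cliffForm (m : ℕ) : QuadraticForm ℝ (EuclideanSpace ℝ (Fin m)) :=
  -LinearMap.BilinMap.toQuadraticMap (innerₗ (EuclideanSpace ℝ (Fin m)))

/-- The Clifford algebra `Cliff_m`. -/
abbrev Cliff (m : ℕ) : Type := CliffordAlgebra (cliffForm m)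

/-- The canonical topology of the finite-dimensional real vector space `Cliff_m`. -/
instance cliffTopology (m : ℕ) : TopologicalSpace (Cliff m) := moduleTopology ℝ (Cliff m)

/-- The group `Spin(m)`, inside `Cliff_m` and with the topology induced from it. -/
abbrev Spin (m : ℕ) : Type := spinGroup (cliffForm m)

/-- The real-linear map `ℝ^{2n} → End (Λ ℂⁿ)` sending the basis vector `γ_k` to the operator
`φ_j` or `π_j` which the ordering `e` puts in the `k`-th place. -/
def gammaMap {n : ℕ} (e : Fin (2 * n) ≃ Fin n ⊕ Fin n) :
    EuclideanSpace ℝ (Fin (2 * n)) →ₗ[ℝ] Module.End ℂ (ExtAlg n) where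
  toFun v := ∑ k, ((v k : ℝ) : ℂ) • gammaOp (e k)
  map_add' v w := by simp [add_smul, Finset.sum_add_distrib]
  map_smul' r v := by
    simp only [PiLp.smul_apply, smul_eq_mul, Complex.ofReal_mul, mul_smul, RingHom.id_apply,
      Finset.smul_sum]
    rfl

theorem gammaMap_eq {n : ℕ} (e : Fin (2 * n) ≃ Fin n ⊕ Fin n)
    (v : EuclideanSpace ℝ (Fin (2 * n))) (ψ : ExtAlg n) :
    gammaMap e v ψ =
      CliffordAlgebra.contractLeft (∑ j, (Complex.I * v (e.symm (.inl j)) + v (e.symm (.inr j))) •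
        coordFn j) ψ +
      ExteriorAlgebra.ι ℂ (∑ j, (Complex.I * v (e.symm (.inl j)) - v (e.symm (.inr j))) •
        EuclideanSpace.single j (1 : ℂ)) * ψ := by
  have h : gammaMap e v = ∑ k, ((v k : ℝ) : ℂ) • gammaOp (e k) := rfl
  rw [h, ← e.symm.sum_comp, Fintype.sum_sum_type]
  simp only [Equiv.apply_symm_apply, gammaOp, annihilation, creation, ext1, map_sum, map_smul,
    LinearMap.add_apply, LinearMap.sum_apply, LinearMap.smul_apply, LinearMap.sub_apply,
    LinearMap.mulLeft_apply, Finset.sum_mul, smul_mul_assoc, ← Finset.sum_add_distrib]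
  refine Finset.sum_congr rfl fun j _ => ?_
  module

theorem gammaMap_sq {n : ℕ} (e : Fin (2 * n) ≃ Fin n ⊕ Fin n)
    (v : EuclideanSpace ℝ (Fin (2 * n))) :
    gammaMap e v * gammaMap e v = algebraMap ℝ (Module.End ℂ (ExtAlg n)) (cliffForm (2 * n) v) := by
  have hQ : (cliffForm (2 * n) v : ℂ) = ∑ j, (Complex.I * v (e.symm (.inl j)) +
      v (e.symm (.inr j))) * (Complex.I * v (e.symm (.inl j)) - v (e.symm (.inr j))) := by
    have : cliffForm (2 * n) v = -∑ k, v k * v k := by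
      simp [cliffForm, ← sq, EuclideanSpace.real_norm_sq_eq]
    rw [this, ← e.symm.sum_comp, Fintype.sum_sum_type, ← Finset.sum_add_distrib]
    push_cast
    rw [← Finset.sum_neg_distrib]
    refine Finset.sum_congr rfl fun j _ => ?_
    linear_combination -(v (e.symm (.inl j)) : ℂ) ^ 2 * Complex.I_sq
  have hr : algebraMap ℝ (Module.End ℂ (ExtAlg n)) (cliffForm (2 * n) v) =
      algebraMap ℂ (Module.End ℂ (ExtAlg n)) (cliffForm (2 * n) v : ℂ) := rfl
  rw [hr, hQ]
  refine LinearMap.ext fun ψ => ?_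
  rw [Module.End.mul_apply, gammaMap_eq, gammaMap_eq]
  set d : Module.Dual ℂ (EuclideanSpace ℂ (Fin n)) :=
    ∑ j, (Complex.I * v (e.symm (.inl j)) + v (e.symm (.inr j))) • coordFn j with hd
  set w : EuclideanSpace ℂ (Fin n) := ∑ j, (Complex.I * v (e.symm (.inl j)) -
    v (e.symm (.inr j))) • EuclideanSpace.single j (1 : ℂ) with hw
  have hdw : d w = ∑ j, (Complex.I * v (e.symm (.inl j)) + v (e.symm (.inr j))) *
      (Complex.I * v (e.symm (.inl j)) - v (e.symm (.inr j))) := by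
    simp [hd, hw, coordFn, mul_comm]
  have h1 : CliffordAlgebra.contractLeft d (ExteriorAlgebra.ι ℂ w * ψ) =
      d w • ψ - ExteriorAlgebra.ι ℂ w * CliffordAlgebra.contractLeft d ψ :=
    CliffordAlgebra.contractLeft_ι_mul _ _ _
  have h2 : ExteriorAlgebra.ι ℂ w * (ExteriorAlgebra.ι ℂ w * ψ) = 0 := by
    rw [← mul_assoc, ExteriorAlgebra.ι_sq_zero, zero_mul]
  rw [map_add, CliffordAlgebra.contractLeft_contractLeft, mul_add, h1, h2, ← hdw,
    Module.algebraMap_end_apply]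
  abel

/-- The action of `Cliff_{2n}` on `Λ ℂⁿ`. -/
def cliffAction {n : ℕ} (e : Fin (2 * n) ≃ Fin n ⊕ Fin n) :
    Cliff (2 * n) →ₐ[ℝ] Module.End ℂ (ExtAlg n) :=
  CliffordAlgebra.lift (cliffForm (2 * n)) ⟨gammaMap e, gammaMap_sq e⟩

/-- The Dirac spinor representation of `Spin(2n)` on `Λ ℂⁿ`. -/
def dirac {n : ℕ} (e : Fin (2 * n) ≃ Fin n ⊕ Fin n) : Representation ℂ (Spin (2 * n)) (ExtAlg n) :=
  ((cliffAction e : Cliff (2 * n) →ₐ[ℝ] Module.End ℂ (ExtAlg n)) :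
    Cliff (2 * n) →* Module.End ℂ (ExtAlg n)).comp (spinGroup (cliffForm (2 * n))).subtype

/-- The tensor product of Dirac spinor representations of `Spin(4) × Spin(6)` on
`Λ ℂ² ⊗ Λ ℂ³`. -/
def diracTensor (e₂ : Fin (2 * 2) ≃ Fin 2 ⊕ Fin 2) (e₃ : Fin (2 * 3) ≃ Fin 3 ⊕ Fin 3) :
    Representation ℂ (Spin (2 * 2) × Spin (2 * 3)) (ExtAlg 2 ⊗[ℂ] ExtAlg 3) :=
  Representation.tprod ((dirac e₂).comp (MonoidHom.fst _ _)) ((dirac e₃).comp (MonoidHom.snd _ _))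

/-! ## The Standard Model representation -/

/-- The gauge group `G_SM = U(1) × SU(2) × SU(3)`. -/
abbrev GSM : Type :=
  Circle × Matrix.specialUnitaryGroup (Fin 2) ℂ × Matrix.specialUnitaryGroup (Fin 3) ℂ

/-- The basis of the fermion representation `F`. The isospin indices `0, 1 : Fin 2` mean up and
down (so `leptonL 0` is `ν_L`, `leptonL 1` is `e⁻_L`, `quarkL 0 c` is `u^c_L` and `quarkL 1 c` is
`d^c_L`), and the colour indices `0, 1, 2 : Fin 3` mean red, green and blue. -/
inductive Fermion : Type
  | leptonL (i : Fin 2)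
  | quarkL (i : Fin 2) (c : Fin 3)
  | neutrinoR
  | electronR
  | upR (c : Fin 3)
  | downR (c : Fin 3)
  deriving DecidableEq, Fintype

theorem Fermion.sum_eq (f : Fermion → ℂ) :
    ∑ x, f x = (∑ i, f (.leptonL i)) + (∑ i, ∑ c, f (.quarkL i c)) + f .neutrinoR +
      f .electronR + (∑ c, f (.upR c)) + ∑ c, f (.downR c) := by
  have h : (Finset.univ : Finset Fermion) =
      {.leptonL 0, .leptonL 1, .quarkL 0 0, .quarkL 0 1, .quarkL 0 2, .quarkL 1 0, .quarkL 1 1,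
        .quarkL 1 2, .neutrinoR, .electronR, .upR 0, .upR 1, .upR 2, .downR 0, .downR 1,
        .downR 2} := by decide
  rw [h]
  simp [Fin.sum_univ_succ]
  ring

/-- The matrix by which `(α, g, h)` acts on `F`, the direct sum of
`ℂ_{-1} ⊗ ℂ² ⊗ ℂ` (left-handed leptons), `ℂ_{1/3} ⊗ ℂ² ⊗ ℂ³` (left-handed quarks),
`ℂ_0 ⊗ ℂ ⊗ ℂ` (right-handed neutrino), `ℂ_{-2} ⊗ ℂ ⊗ ℂ` (right-handed electron),
`ℂ_{4/3} ⊗ ℂ ⊗ ℂ³` (right-handed up quarks) and `ℂ_{-2/3} ⊗ ℂ ⊗ ℂ³` (right-handed down quarks).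
Here `α` acts on `ℂ_Y` as multiplication by `α ^ (3 * Y)`. -/
def fermionMatrix (x : GSM) : Matrix Fermion Fermion ℂ
  | .leptonL i, .leptonL j => (x.1 : ℂ) ^ (-3 : ℤ) * x.2.1.1 i j
  | .quarkL i c, .quarkL j d => (x.1 : ℂ) ^ (1 : ℤ) * x.2.1.1 i j * x.2.2.1 c d
  | .neutrinoR, .neutrinoR => (x.1 : ℂ) ^ (0 : ℤ)
  | .electronR, .electronR => (x.1 : ℂ) ^ (-6 : ℤ)
  | .upR c, .upR d => (x.1 : ℂ) ^ (4 : ℤ) * x.2.2.1 c d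
  | .downR c, .downR d => (x.1 : ℂ) ^ (-2 : ℤ) * x.2.2.1 c d
  | _, _ => 0

/-- The fermion representation, in matrix form. -/
def fermionHom : GSM →* Matrix Fermion Fermion ℂ where
  toFun := fermionMatrix
  map_one' := by
    ext x y
    cases x <;> cases y <;>
      simp [fermionMatrix, Matrix.one_apply, ← ite_and, and_comm]
  map_mul' a b := by
    ext x y
    rw [Matrix.mul_apply, Fermion.sum_eq]
    cases x <;> cases y <;>
      simp [fermionMatrix, Matrix.mul_apply, Fin.sum_univ_succ] <;> ring

/-- The Hilbert space `F ⊕ F*`. The basis vector with label `inl x` is the fermion `x`, and the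
one with label `inr x` is the vector `x*` of the dual basis of `F*`. -/
abbrev SMSpace : Type := EuclideanSpace ℂ (Fermion ⊕ Fermion)

/-- The Standard Model representation on `F ⊕ F*`. -/
def smRep : Representation ℂ GSM SMSpace := matrixRep (withDual fermionHom)

/-! ## The Pati--Salam representation -/

/-- The labels `r, g, b` (as `inl 0, inl 1, inl 2`) and `w` (as `inr ()`) of the basis of `ℂ⁴`. -/
abbrev Color : Type := Fin 3 ⊕ Unit

/-- The Pati--Salam gauge group `SU(2) × SU(2) × SU(4)`. -/
abbrev PSGroup : Type :=
  Matrix.specialUnitaryGroup (Fin 2) ℂ × Matrix.specialUnitaryGroup (Fin 2) ℂ ×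
    Matrix.specialUnitaryGroup Color ℂ

/-- The space `(ℂ² ⊗ ℂ) ⊕ (ℂ ⊗ ℂ²)`, with basis `u_L, d_L` (as `inl 0, inl 1`) and
`u_R, d_R` (as `inr 0, inr 1`). -/
abbrev IsospinSpace : Type := EuclideanSpace ℂ (Fin 2 ⊕ Fin 2)

/-- The space `ℂ⁴ ⊕ ℂ⁴*`, where `inl c` labels the basis `r, g, b, w` of `ℂ⁴` and `inr c`
labels the dual basis of `ℂ⁴*`. -/
abbrev ColorSpace : Type := EuclideanSpace ℂ (Color ⊕ Color)

/-- `SU(2) × SU(2)` acting on `(ℂ² ⊗ ℂ) ⊕ (ℂ ⊗ ℂ²)`. -/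
def isospinRep : Representation ℂ PSGroup IsospinSpace := matrixRep
  { toFun := fun x => Matrix.fromBlocks x.1.1 0 0 x.2.1.1
    map_one' := by simp
    map_mul' := fun x y => by simp [Matrix.fromBlocks_multiply] }

/-- `SU(4)` acting on `ℂ⁴ ⊕ ℂ⁴*`. -/
def colorRep : Representation ℂ PSGroup ColorSpace := matrixRep <| withDual
  { toFun := fun x => x.2.2.1
    map_one' := rfl
    map_mul' := fun _ _ => rfl }

/-- The space `((ℂ² ⊗ ℂ) ⊕ (ℂ ⊗ ℂ²)) ⊗ (ℂ⁴ ⊕ ℂ⁴*)`. -/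
abbrev PSSpace : Type := IsospinSpace ⊗[ℂ] ColorSpace

/-- The Pati--Salam representation. -/
def psRep : Representation ℂ PSGroup PSSpace := Representation.tprod isospinRep colorRep

/-- The matrix `diag(α³, α⁻³)` in `SU(2)`. -/
def betaR (α : Circle) : Matrix.specialUnitaryGroup (Fin 2) ℂ :=
  ⟨Matrix.diagonal ![(α : ℂ) ^ (3 : ℤ), (α : ℂ) ^ (-3 : ℤ)], by
    have h : ∀ m : ℤ, (α : ℂ) ^ m * (starRingEnd ℂ) ((α : ℂ) ^ m) = 1 := fun m => by
      rw [Complex.mul_conj, Complex.normSq_eq_norm_sq, norm_zpow, Circle.norm_coe]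
      simp
    rw [Matrix.mem_specialUnitaryGroup_iff, Matrix.mem_unitaryGroup_iff]
    refine ⟨?_, ?_⟩
    · rw [Matrix.star_eq_conjTranspose, Matrix.diagonal_conjTranspose, Matrix.diagonal_mul_diagonal,
        ← Matrix.diagonal_one]
      congr 1
      ext i
      fin_cases i
      · exact h 3
      · exact h (-3)
    · simp [Matrix.det_diagonal, Fin.prod_univ_succ]⟩

/-- The block matrix `(α h, 0; 0, α⁻³)` in `SU(4)`. -/
def betaC (α : Circle) (h0 : Matrix.specialUnitaryGroup (Fin 3) ℂ) :
    Matrix.specialUnitaryGroup Color ℂ :=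
  ⟨Matrix.fromBlocks ((α : ℂ) • h0.1) 0 0 (Matrix.diagonal fun _ => (α : ℂ) ^ (-3 : ℤ)), by
    have h : ∀ m : ℤ, (α : ℂ) ^ m * (starRingEnd ℂ) ((α : ℂ) ^ m) = 1 := fun m => by
      rw [Complex.mul_conj, Complex.normSq_eq_norm_sq, norm_zpow, Circle.norm_coe]
      simp
    have h1 : (α : ℂ) * (starRingEnd ℂ) (α : ℂ) = 1 := by simpa using h 1
    have h2 := Matrix.mem_specialUnitaryGroup_iff.mp h0.2
    rw [Matrix.mem_unitaryGroup_iff, Matrix.star_eq_conjTranspose] at h2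
    rw [Matrix.mem_specialUnitaryGroup_iff, Matrix.mem_unitaryGroup_iff,
      Matrix.star_eq_conjTranspose, Matrix.fromBlocks_conjTranspose, Matrix.fromBlocks_multiply]
    refine ⟨?_, ?_⟩
    · rw [← Matrix.fromBlocks_one]
      congr 1
      · simp [Matrix.conjTranspose_smul, smul_smul, h2.1, mul_comm, h1]
      · simp
      · simp
      · rw [Matrix.diagonal_conjTranspose, Matrix.diagonal_mul_diagonal]
        ext i j
        simpa [Matrix.diagonal_apply, Matrix.one_apply] using h (-3)
    · rw [Matrix.det_fromBlocks_zero₂₁, Matrix.det_smul, h2.2]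
      simp⟩

/-- The homomorphism `β : G_SM → SU(2) × SU(2) × SU(4)`. -/
def beta : GSM →* PSGroup where
  toFun x := (x.2.1, betaR x.1, betaC x.1 x.2.2)
  map_one' := by
    refine Prod.ext rfl (Prod.ext (Subtype.ext ?_) (Subtype.ext ?_))
    · ext i j
      fin_cases i <;> fin_cases j <;> simp [betaR]
    · simp [betaC]
  map_mul' x y := by
    refine Prod.ext rfl (Prod.ext (Subtype.ext ?_) (Subtype.ext ?_))
    · ext i j
      fin_cases i <;> fin_cases j <;> simp [betaR, mul_pow, mul_comm]
    · simp [betaC, Matrix.fromBlocks_multiply, smul_smul, mul_pow, mul_comm]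

/-! ## The operators `ℓ`, `k` and `h` -/

/-- The tensor product of basis vectors of the two factors of the Pati--Salam space. -/
def psVec (i : Fin 2 ⊕ Fin 2) (c : Color ⊕ Color) : PSSpace :=
  EuclideanSpace.single i (1 : ℂ) ⊗ₜ[ℂ] EuclideanSpace.single c (1 : ℂ)

/-- The Pati--Salam code. The right-handed antifermions are taken to be
`e⁺_R = (e⁻_L)*`, `ν̄_R = -(ν_L)*`, `d̄_R = (d_L)*`, `ū_R = -(u_L)*`, as dictated by the isomorphism
`ℂ²* ≅ ℂ²` of representations of `SU(2)`, and the left-handed antifermions are the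
`e⁺_L = (e⁻_R)*`, `ν̄_L = (ν_R)*`, `d̄_L = (d_R)*`, `ū_L = (u_R)*`. -/
def psCode : Fermion ⊕ Fermion → PSSpace
  | .inl (.leptonL i) => psVec (.inl i) (.inl (.inr ()))
  | .inl (.quarkL i c) => psVec (.inl i) (.inl (.inl c))
  | .inl .neutrinoR => psVec (.inr 0) (.inl (.inr ()))
  | .inl .electronR => psVec (.inr 1) (.inl (.inr ()))
  | .inl (.upR c) => psVec (.inr 0) (.inl (.inl c))
  | .inl (.downR c) => psVec (.inr 1) (.inl (.inl c))
  | .inr (.leptonL 1) => psVec (.inl 0) (.inr (.inr ()))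
  | .inr (.leptonL 0) => -psVec (.inl 1) (.inr (.inr ()))
  | .inr (.quarkL 1 c) => psVec (.inl 0) (.inr (.inl c))
  | .inr (.quarkL 0 c) => -psVec (.inl 1) (.inr (.inl c))
  | .inr .electronR => psVec (.inr 0) (.inr (.inr ()))
  | .inr .neutrinoR => psVec (.inr 1) (.inr (.inr ()))
  | .inr (.downR c) => psVec (.inr 0) (.inr (.inl c))
  | .inr (.upR c) => psVec (.inr 1) (.inr (.inl c))

/-- The tensor product basis of the Pati--Salam space. -/
def psONB : OrthonormalBasis ((Fin 2 ⊕ Fin 2) × (Color ⊕ Color)) ℂ PSSpace :=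
  (EuclideanSpace.basisFun _ ℂ).tensorProduct (EuclideanSpace.basisFun _ ℂ)

theorem psONB_apply (i : Fin 2 ⊕ Fin 2) (c : Color ⊕ Color) : psONB (i, c) = psVec i c := by
  simp [psONB, psVec]

/-- The label of the basis vector of the Pati--Salam space to which a basis vector of `F ⊕ F*`
is sent, up to sign. -/
def psLabel : Fermion ⊕ Fermion → (Fin 2 ⊕ Fin 2) × (Color ⊕ Color)
  | .inl (.leptonL i) => (.inl i, .inl (.inr ()))
  | .inl (.quarkL i c) => (.inl i, .inl (.inl c))
  | .inl .neutrinoR => (.inr 0, .inl (.inr ()))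
  | .inl .electronR => (.inr 1, .inl (.inr ()))
  | .inl (.upR c) => (.inr 0, .inl (.inl c))
  | .inl (.downR c) => (.inr 1, .inl (.inl c))
  | .inr (.leptonL i) => (.inl (1 - i), .inr (.inr ()))
  | .inr (.quarkL i c) => (.inl (1 - i), .inr (.inl c))
  | .inr .electronR => (.inr 0, .inr (.inr ()))
  | .inr .neutrinoR => (.inr 1, .inr (.inr ()))
  | .inr (.downR c) => (.inr 0, .inr (.inl c))
  | .inr (.upR c) => (.inr 1, .inr (.inl c))

theorem psCode_orthonormal : Orthonormal ℂ psCode := by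
  refine orthonormal_of_signed psONB psLabel (by decide)
    (fun x => if x = .inr (.leptonL 0) ∨ ∃ c, x = .inr (.quarkL 0 c) then -1 else 1) ?_
  rintro ((i | ⟨i, c⟩ | _ | _ | c | c) | (i | ⟨i, c⟩ | _ | _ | c | c))
  all_goals try (fin_cases i)
  all_goals simp [psCode, psLabel, psONB_apply]

/-- The unitary operator `ℓ : F ⊕ F* → ((ℂ² ⊗ ℂ) ⊕ (ℂ ⊗ ℂ²)) ⊗ (ℂ⁴ ⊕ ℂ⁴*)`. -/
def ellOp : SMSpace ≃ₗᵢ[ℂ] PSSpace :=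
  unitaryOfFamily psCode psCode_orthonormal (by
    rw [Module.finrank_eq_card_basis psONB.toBasis]
    rfl)

/-- The images of the isospin basis: `u_L ↦ u`, `d_L ↦ d`, `u_R ↦ u ∧ d`, `d_R ↦ 1`. -/
def isospinCode : Fin 2 ⊕ Fin 2 → ExtAlg 2
  | .inl i => ext1 i
  | .inr 0 => ext1 0 * ext1 1
  | .inr 1 => 1

theorem extONB_eq {n p : ℕ} (f : Fin p → Fin n) (hf : StrictMono f) {s : Finset (Fin n)}
    (hs : s = Finset.univ.image f) : extONB n s = (List.ofFn fun i => ext1 (f i)).prod := by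
  have h : s = (Set.powersetCard.ofFinEmbEquiv (OrderEmbedding.ofStrictMono f hf)).val := by
    rw [hs]
    ext i
    simp [← Finset.mem_coe]
  rw [extONB, Module.Basis.coe_toOrthonormalBasis, extBasis, h,
    ExteriorAlgebra.basis_apply_powersetCard]
  simp [ExteriorAlgebra.ιMulti_apply, ext1]

theorem isospinCode_orthonormal : Orthonormal ℂ isospinCode := by
  refine orthonormal_of_signed (extONB 2)
    (Sum.elim (fun i => {i}) ![{0, 1}, ∅]) (by decide) (fun _ => 1) ?_
  rintro (i | i)
  · simp [isospinCode, extONB_eq (s := {i}) (fun _ : Fin 1 => i) (Subsingleton.strictMono _)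
      (by simp)]
  · fin_cases i
    · simp [isospinCode, extONB_eq (s := ({0, 1} : Finset (Fin 2))) ![0, 1] (by decide) (by decide)]
    · simp [isospinCode, extONB_eq (s := (∅ : Finset (Fin 2))) ![] (by decide) (by decide)]

/-- The unitary operator `(ℂ² ⊗ ℂ) ⊕ (ℂ ⊗ ℂ²) ≃ Λ ℂ²`. -/
def isospinOp : IsospinSpace ≃ₗᵢ[ℂ] ExtAlg 2 :=
  unitaryOfFamily isospinCode isospinCode_orthonormal (by
    rw [Module.finrank_eq_card_basis (extBasis 2)]
    rfl)

/-- The images of the colour basis: `r ↦ r`, `g ↦ g`, `b ↦ b`, `w ↦ r ∧ g ∧ b`, and on the dual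
basis `r̄ ↦ g ∧ b`, `ḡ ↦ b ∧ r`, `b̄ ↦ r ∧ g`, `w̄ ↦ ε`. For `ε = 1` this is the Hodge dual basis;
`ε = -1` is the sign for which the map `ℂ⁴* ≃ Λ^ev ℂ³` is the dual of `ℂ⁴ ≃ Λ^odd ℂ³` as a
representation of `Spin(6)`. -/
def colorCode (ε : ℤˣ) : Color ⊕ Color → ExtAlg 3
  | .inl (.inl c) => ext1 c
  | .inl (.inr ()) => ext1 0 * ext1 1 * ext1 2
  | .inr (.inl 0) => ext1 1 * ext1 2
  | .inr (.inl 1) => ext1 2 * ext1 0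
  | .inr (.inl 2) => ext1 0 * ext1 1
  | .inr (.inr ()) => ((ε : ℤ) : ℂ) • 1

theorem colorCode_orthonormal (ε : ℤˣ) : Orthonormal ℂ (colorCode ε) := by
  refine orthonormal_of_signed (extONB 3)
    (Sum.elim (Sum.elim (fun c => {c}) fun _ => {0, 1, 2})
      (Sum.elim ![{1, 2}, {0, 2}, {0, 1}] fun _ => ∅)) (by decide)
    (Sum.elim (fun _ => 1) (Sum.elim ![1, -1, 1] fun _ => ε)) ?_
  rintro ((c | ⟨⟩) | (c | ⟨⟩))
  · simp [colorCode, extONB_eq (s := {c}) (fun _ : Fin 1 => c) (Subsingleton.strictMono _)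
      (by simp)]
  · simp [colorCode, mul_assoc, extONB_eq (s := ({0, 1, 2} : Finset (Fin 3))) ![0, 1, 2]
      (by decide) (by decide)]
  · fin_cases c
    · simp [colorCode, extONB_eq (s := ({1, 2} : Finset (Fin 3))) ![1, 2] (by decide) (by decide)]
    · have h : ext1 2 * ext1 0 = -(ext1 0 * ext1 2 : ExtAlg 3) :=
        eq_neg_of_add_eq_zero_left (ExteriorAlgebra.ι_add_mul_swap _ _)
      simp [colorCode, h, extONB_eq (s := ({0, 2} : Finset (Fin 3))) ![0, 2] (by decide) (by decide)]
    · simp [colorCode, extONB_eq (s := ({0, 1} : Finset (Fin 3))) ![0, 1] (by decide) (by decide)]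
  · simp [colorCode, extONB_eq (s := (∅ : Finset (Fin 3))) ![] (by decide) (by decide)]

/-- The unitary operator `ℂ⁴ ⊕ ℂ⁴* ≃ Λ ℂ³`. -/
def colorOp (ε : ℤˣ) : ColorSpace ≃ₗᵢ[ℂ] ExtAlg 3 :=
  unitaryOfFamily (colorCode ε) (colorCode_orthonormal ε) (by
    rw [Module.finrank_eq_card_basis (extBasis 3)]
    rfl)

/-- The unitary operator `k : ((ℂ² ⊗ ℂ) ⊕ (ℂ ⊗ ℂ²)) ⊗ (ℂ⁴ ⊕ ℂ⁴*) → Λ ℂ² ⊗ Λ ℂ³`. -/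
def kOp (ε : ℤˣ) : PSSpace ≃ₗᵢ[ℂ] ExtAlg 2 ⊗[ℂ] ExtAlg 3 :=
  TensorProduct.congrIsometry isospinOp (colorOp ε)

/-- The unitary operator `h = k ℓ`. -/
def hOp (ε : ℤˣ) : SMSpace ≃ₗᵢ[ℂ] ExtAlg 2 ⊗[ℂ] ExtAlg 3 := ellOp.trans (kOp ε)

/-- The condition that pins down the isomorphism `α : SU(2) × SU(2) × SU(4) → Spin(4) × Spin(6)`:
the three unitary operators `ℂ² ⊗ ℂ ≃ Λ^odd ℂ²`, `ℂ ⊗ ℂ² ≃ Λ^ev ℂ²` (together: `isospinOp`) and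
`ℂ⁴ ≃ Λ^odd ℂ³` (the restriction of `colorOp` to `ℂ⁴`) carry the action of `SU(2) × SU(2)` on
`(ℂ² ⊗ ℂ) ⊕ (ℂ ⊗ ℂ²)` and that of `SU(4)` on `ℂ⁴` to the Dirac spinor representations of
`Spin(4)` on `Λ ℂ²` and of `Spin(6)` on `Λ^odd ℂ³`. Nothing is required on `Λ^ev ℂ³`, so the sign
in `colorOp` does not matter here. -/
structure IsSpinorIso (e₂ : Fin (2 * 2) ≃ Fin 2 ⊕ Fin 2) (e₃ : Fin (2 * 3) ≃ Fin 3 ⊕ Fin 3)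
    (α : PSGroup ≃ₜ* Spin (2 * 2) × Spin (2 * 3)) : Prop where
  isospin : ∀ x v, dirac e₂ (α x).1 (isospinOp v) = isospinOp (isospinRep x v)
  color : ∀ x (c : Color), dirac e₃ (α x).2 (colorOp 1 (EuclideanSpace.single (.inl c) 1)) =
    colorOp 1 (colorRep x (EuclideanSpace.single (.inl c) 1))

/-- The homomorphism `θ = α β : G_SM → Spin(4) × Spin(6)`. -/
def theta (α : PSGroup ≃ₜ* Spin (2 * 2) × Spin (2 * 3)) :
    GSM →* Spin (2 * 2) × Spin (2 * 3) :=
  α.toMulEquiv.toMonoidHom.comp beta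

end PatiSalam

end

open PatiSalam

namespace PatiSalam

/-! Vectors act on Λ ℂⁿ by anti-Hermitian operators, so the real Clifford algebra acts by a
*-representation and Spin(2n) acts unitarily. The complex span of the image contains all creation
and annihilation operators, hence is all of End(Λ ℂⁿ). Counting real dimensions, every operator is x
+ iy for unique Clifford elements x, y. So the real action is faithful, its center is ℝ, and an
invertible antilinear operator ψ ↦ J ψ̄ commuting with all vectors singles out the Clifford elements
among the complex matrices (`exists_cliffMatrix_eq`). Adding parity, unitarity and stability of the
space of vectors under conjugation gives a description of Spin(2n) by matrix conditions alone
(`exists_spin_cliffMatrix_eq`). The passage from these conditions back to products of vectors is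
Cartan–Dieudonné.

In suitable bases a vector has two off-diagonal blocks, so even elements are block diagonal. On Λ ℂ²
the operator J is the symplectic form on each block, and what survives is SU(2) × SU(2). On Λ ℂ³, in
the basis with sign ε = -1, J exchanges ℂ⁴ and ℂ⁴*, so even elements are pairs (g, ḡ) with g
unitary. Vectors become the skew 4 × 4 matrices whose complex conjugate is their Hodge dual, and a
unitary g respects this real form exactly when det g = 1 (`exists_mul_skew_mul_transpose`). This is
SU(4) → SO(6) on Λ²ℂ⁴.

Hence SU(2) × SU(2) × SU(4) and Spin(4) × Spin(6) are embedded with the same image in the same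
matrices, which gives α. It is unique because the spinors are faithful and the action g on ℂ⁴
already forces ḡ on the other half.

The map ℓ intertwines along β because hypercharges add up and the signs in the code realize ℂ²* ≅
ℂ². The sign ε does not affect the square, because β(G_SM) never mixes w̄ with the other dual
colours. -/

/-! ### Creation and annihilation operators; the Clifford action as a *-representation -/

theorem extBasis_eq_extONB {n : ℕ} (s : Finset (Fin n)) : extBasis n s = extONB n s := by
  simp [extONB]

theorem extBasis_empty (n : ℕ) : extBasis n ∅ = 1 := by
  rw [extBasis_eq_extONB, extONB_eq (s := (∅ : Finset (Fin n))) Fin.elim0 (fun i => i.elim0) (by simp)]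
  simp

theorem extBasis_singleton {n : ℕ} (j : Fin n) : extBasis n {j} = ext1 j := by
  rw [extBasis_eq_extONB, extONB_eq (s := {j}) (fun _ : Fin 1 => j) (Subsingleton.strictMono _)
    (by simp)]
  simp

/-- The sign of the shuffle is kept only as an unspecified unit: in every later use it occurs twice
and cancels. -/
theorem extBasis_mul_of_disjoint {n : ℕ} {s t : Finset (Fin n)} (h : Disjoint s t) :
    ∃ ε : ℤˣ, extBasis n s * extBasis n t = ((ε : ℤ) : ℂ) • extBasis n (s ∪ t) := by
  let s' : Set.powersetCard (Fin n) s.card := Set.powersetCard.ofCard rfl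
  let t' : Set.powersetCard (Fin n) t.card := Set.powersetCard.ofCard rfl
  have h' : Disjoint s'.val t'.val := h
  have := ExteriorAlgebra.basis_mul_of_disjoint (EuclideanSpace.basisFun (Fin n) ℂ).toBasis s' t' h'
  rw [Units.smul_def, ← Int.cast_smul_eq_zsmul ℂ] at this
  refine ⟨Equiv.Perm.sign (Set.powersetCard.permOfDisjoint h'), this.trans ?_⟩
  simp [s', t', extBasis, Set.powersetCard.disjUnion, Finset.disjUnion_eq_union]

theorem creation_extBasis_of_notMem {n : ℕ} {j : Fin n} {s : Finset (Fin n)} (h : j ∉ s) :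
    ∃ ε : ℤˣ, creation j (extBasis n s) = ((ε : ℤ) : ℂ) • extBasis n (insert j s) := by
  obtain ⟨ε, hε⟩ := extBasis_mul_of_disjoint (Finset.disjoint_singleton_left.mpr h)
  refine ⟨ε, ?_⟩
  rw [creation, LinearMap.mulLeft_apply, ← extBasis_singleton, hε, Finset.insert_eq]

theorem units_smul_smul {V : Type*} [AddCommGroup V] [Module ℂ V] (ε : ℤˣ) (v : V) :
    ((ε : ℤ) : ℂ) • ((ε : ℤ) : ℂ) • v = v := by
  rcases Int.units_eq_one_or ε with e | e <;> simp [e]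

theorem extBasis_insert {n : ℕ} {j : Fin n} {s : Finset (Fin n)} (h : j ∉ s) :
    ∃ ε : ℤˣ, extBasis n (insert j s) = ((ε : ℤ) : ℂ) • creation j (extBasis n s) := by
  obtain ⟨ε, hε⟩ := creation_extBasis_of_notMem h
  exact ⟨ε, by rw [hε, units_smul_smul]⟩

theorem creation_creation {n : ℕ} (j : Fin n) (ψ : ExtAlg n) : creation j (creation j ψ) = 0 := by
  simp only [creation, LinearMap.mulLeft_apply, ext1]
  rw [← mul_assoc, ExteriorAlgebra.ι_sq_zero, zero_mul]

theorem creation_extBasis_of_mem {n : ℕ} {j : Fin n} {s : Finset (Fin n)} (h : j ∈ s) :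
    creation j (extBasis n s) = 0 := by
  obtain ⟨ε, hε⟩ := extBasis_insert (Finset.notMem_erase j s)
  rw [Finset.insert_erase h] at hε
  rw [hε, map_smul, creation_creation, smul_zero]

theorem annihilation_creation {n : ℕ} (i j : Fin n) (ψ : ExtAlg n) :
    annihilation i (creation j ψ) = (if i = j then ψ else 0) - creation j (annihilation i ψ) := by
  have h : annihilation i (creation j ψ) = coordFn i (EuclideanSpace.single j 1) • ψ -
      creation j (annihilation i ψ) := CliffordAlgebra.contractLeft_ι_mul _ _ _
  rw [h]
  simp [coordFn, ite_smul]

theorem annihilation_one {n : ℕ} (j : Fin n) : annihilation j (1 : ExtAlg n) = 0 :=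
  CliffordAlgebra.contractLeft_one _ (coordFn j)

theorem annihilation_extBasis_of_notMem {n : ℕ} {j : Fin n} {s : Finset (Fin n)} (h : j ∉ s) :
    annihilation j (extBasis n s) = 0 := by
  induction s using Finset.induction_on with
  | empty => rw [extBasis_empty, annihilation_one]
  | insert k s hk ih =>
    rw [Finset.mem_insert, not_or] at h
    obtain ⟨ε, hε⟩ := extBasis_insert hk
    rw [hε, map_smul, annihilation_creation, if_neg h.1, ih h.2]
    simp

theorem annihilation_creation_extBasis {n : ℕ} {j : Fin n} {s : Finset (Fin n)} (h : j ∉ s) :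
    annihilation j (creation j (extBasis n s)) = extBasis n s := by
  rw [annihilation_creation, if_pos rfl, annihilation_extBasis_of_notMem h, map_zero, sub_zero]

theorem inner_extBasis {n : ℕ} (s t : Finset (Fin n)) :
    ⟪extBasis n s, extBasis n t⟫_ℂ = if s = t then 1 else 0 := by
  rw [extBasis_eq_extONB, extBasis_eq_extONB, orthonormal_iff_ite.mp (extONB n).orthonormal]

/-- Both matrix coefficients vanish at a pair s, t unless s is t with j adjoined. In that case the
same reordering sign appears on both sides. -/
theorem star_creation {n : ℕ} (j : Fin n) :
    star (creation j : Module.End ℂ (ExtAlg n)) = annihilation j := by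
  rw [LinearMap.star_eq_adjoint]
  symm
  rw [LinearMap.eq_adjoint_iff_basis (extBasis n) (extBasis n)]
  intro s t
  by_cases hs : j ∈ s
  · obtain ⟨ε, hε⟩ := extBasis_insert (Finset.notMem_erase j s)
    rw [Finset.insert_erase hs] at hε
    have h1 : annihilation j (extBasis n s) = ((ε : ℤ) : ℂ) • extBasis n (s.erase j) := by
      rw [hε, map_smul, annihilation_creation_extBasis (Finset.notMem_erase j s)]
    by_cases ht : j ∈ t
    · rw [creation_extBasis_of_mem ht, inner_zero_right, h1, inner_smul_left, inner_extBasis,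
        if_neg, mul_zero]
      rintro rfl
      simp at ht
    · by_cases hst : s.erase j = t
      · subst hst
        have h2 : creation j (extBasis n (s.erase j)) = ((ε : ℤ) : ℂ) • extBasis n s := by
          rw [hε, units_smul_smul]
        rw [h1, h2, inner_smul_left, inner_smul_right, inner_extBasis, inner_extBasis]
        simp
      · obtain ⟨δ, hδ⟩ := creation_extBasis_of_notMem ht
        rw [h1, hδ, inner_smul_left, inner_smul_right, inner_extBasis, inner_extBasis,
          if_neg hst, if_neg, mul_zero, mul_zero]
        rintro rfl
        exact hst (Finset.erase_insert ht)
  · rw [annihilation_extBasis_of_notMem hs, inner_zero_left]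
    by_cases ht : j ∈ t
    · rw [creation_extBasis_of_mem ht, inner_zero_right]
    · obtain ⟨δ, hδ⟩ := creation_extBasis_of_notMem ht
      rw [hδ, inner_smul_right, inner_extBasis, if_neg, mul_zero]
      rintro rfl
      simp at hs

theorem star_annihilation {n : ℕ} (j : Fin n) :
    star (annihilation j : Module.End ℂ (ExtAlg n)) = creation j := by
  rw [← star_creation, star_star]

theorem star_gammaOp {n : ℕ} (k : Fin n ⊕ Fin n) : star (gammaOp k) = -gammaOp k := by
  rcases k with j | j
  · simp [gammaOp, star_creation, star_annihilation, add_comm]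
  · simp [gammaOp, star_creation, star_annihilation]

theorem cliffAction_ι {n : ℕ} (e : Fin (2 * n) ≃ Fin n ⊕ Fin n)
    (v : EuclideanSpace ℝ (Fin (2 * n))) :
    cliffAction e (CliffordAlgebra.ι _ v) = gammaMap e v := by
  simp [cliffAction]

theorem star_gammaMap {n : ℕ} (e : Fin (2 * n) ≃ Fin n ⊕ Fin n)
    (v : EuclideanSpace ℝ (Fin (2 * n))) : star (gammaMap e v) = -gammaMap e v := by
  have h : gammaMap e v = ∑ k, ((v k : ℝ) : ℂ) • gammaOp (e k) := rfl
  rw [h, star_sum, ← Finset.sum_neg_distrib]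
  refine Finset.sum_congr rfl fun k _ => ?_
  rw [star_smul, star_gammaOp]
  simp

/-- The star of the Clifford algebra sends a vector v to -v and reverses products, and so does the
adjoint, since the generators are anti-Hermitian. -/
theorem cliffAction_star {n : ℕ} (e : Fin (2 * n) ≃ Fin n ⊕ Fin n) (x : Cliff (2 * n)) :
    cliffAction e (star x) = star (cliffAction e x) := by
  induction x using CliffordAlgebra.induction with
  | algebraMap r =>
    rw [CliffordAlgebra.star_algebraMap, AlgHom.commutes]
    have hr : algebraMap ℝ (Module.End ℂ (ExtAlg n)) r =
      algebraMap ℂ (Module.End ℂ (ExtAlg n)) (r : ℂ) := rfl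
    rw [hr, Algebra.algebraMap_eq_smul_one, star_smul, star_one]
    simp
  | ι v => rw [CliffordAlgebra.star_ι, map_neg, cliffAction_ι, star_gammaMap]
  | mul x y hx hy => rw [star_mul, map_mul, map_mul, star_mul, hx, hy]
  | add x y hx hy => rw [star_add, map_add, map_add, star_add, hx, hy]

/-! ### The complexified Clifford algebra is the full endomorphism algebra -/

/-- The complex span of the image of the Clifford algebra, as a subalgebra. -/
noncomputable def cliffSpan {n : ℕ} (e : Fin (2 * n) ≃ Fin n ⊕ Fin n) :
    Subalgebra ℂ (Module.End ℂ (ExtAlg n)) where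
  carrier := {T | ∃ x y, T = cliffAction e x + Complex.I • cliffAction e y}
  mul_mem' := by
    rintro _ _ ⟨x, y, rfl⟩ ⟨z, w, rfl⟩
    refine ⟨x * z - y * w, x * w + y * z, ?_⟩
    simp only [add_mul, mul_add, smul_mul_assoc, mul_smul_comm, map_sub, map_add, map_mul]
    rw [smul_add Complex.I (cliffAction e x * cliffAction e w), smul_smul Complex.I Complex.I,
      Complex.I_mul_I]
    module
  add_mem' := by
    rintro _ _ ⟨x, y, rfl⟩ ⟨z, w, rfl⟩
    exact ⟨x + z, y + w, by simp only [map_add]; module⟩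
  algebraMap_mem' c := by
    refine ⟨algebraMap ℝ _ c.re, algebraMap ℝ _ c.im, ?_⟩
    rw [AlgHom.commutes, AlgHom.commutes]
    have hr : ∀ r : ℝ, algebraMap ℝ (Module.End ℂ (ExtAlg n)) r =
      algebraMap ℂ (Module.End ℂ (ExtAlg n)) (r : ℂ) := fun _ => rfl
    rw [hr, hr, Algebra.smul_def, ← map_mul, ← map_add, mul_comm, Complex.re_add_im]

theorem gammaOp_mem_cliffSpan {n : ℕ} (e : Fin (2 * n) ≃ Fin n ⊕ Fin n) (k : Fin n ⊕ Fin n) :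
    gammaOp k ∈ cliffSpan e := by
  refine ⟨CliffordAlgebra.ι _ (EuclideanSpace.single (e.symm k) 1), 0, ?_⟩
  rw [cliffAction_ι, map_zero, smul_zero, add_zero]
  change _ = ∑ i, ((EuclideanSpace.single (e.symm k) (1 : ℝ) i : ℝ) : ℂ) • gammaOp (e i)
  simp [ite_smul, apply_ite]

theorem creation_mem_cliffSpan {n : ℕ} (e : Fin (2 * n) ≃ Fin n ⊕ Fin n) (j : Fin n) :
    creation j ∈ cliffSpan e := by
  have h : creation j = (-(1 / 2 : ℂ) * Complex.I) • gammaOp (.inl j) +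
      (-(1 / 2 : ℂ)) • gammaOp (.inr j) := by
    simp only [gammaOp, smul_smul, mul_assoc, Complex.I_mul_I]
    module
  rw [h]
  exact add_mem (Subalgebra.smul_mem _ (gammaOp_mem_cliffSpan e _) _)
    (Subalgebra.smul_mem _ (gammaOp_mem_cliffSpan e _) _)

theorem annihilation_mem_cliffSpan {n : ℕ} (e : Fin (2 * n) ≃ Fin n ⊕ Fin n) (j : Fin n) :
    annihilation j ∈ cliffSpan e := by
  have h : annihilation j = gammaOp (.inr j) + creation j := by
    simp [gammaOp]
  rw [h]
  exact add_mem (gammaOp_mem_cliffSpan e _) (creation_mem_cliffSpan e j)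

/-- The matrix units of `End (Λ ℂⁿ)` with respect to the induced basis. -/
noncomputable def extUnit {n : ℕ} (s t : Finset (Fin n)) : Module.End ℂ (ExtAlg n) :=
  (extBasis n).constr ℂ fun r => if r = t then extBasis n s else 0

theorem extUnit_extBasis {n : ℕ} (s t r : Finset (Fin n)) :
    extUnit s t (extBasis n r) = if r = t then extBasis n s else 0 := by
  simp [extUnit]

/-- The operator a_k a_k* projects onto the span of the wedge products without e_k, so the product
over all k is the projection onto the vacuum line. -/
theorem extUnit_empty_mem {n : ℕ} (e : Fin (2 * n) ≃ Fin n ⊕ Fin n) :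
    extUnit ∅ ∅ ∈ cliffSpan e := by
  have key : ∀ s : Finset (Fin n), ∃ T ∈ cliffSpan e, ∀ r, T (extBasis n r) =
      if Disjoint r s then extBasis n r else 0 := by
    intro s
    induction s using Finset.induction_on with
    | empty => exact ⟨1, one_mem _, by simp⟩
    | insert k s hk ih =>
      obtain ⟨T, hT, h⟩ := ih
      refine ⟨(annihilation k * creation k) * T, mul_mem (mul_mem (annihilation_mem_cliffSpan e k)
        (creation_mem_cliffSpan e k)) hT, fun r => ?_⟩
      rw [Module.End.mul_apply, h, Module.End.mul_apply]
      by_cases hr : Disjoint r s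
      · by_cases hk : k ∈ r
        · simp [hr, hk, creation_extBasis_of_mem]
        · simp [hr, hk, annihilation_creation_extBasis]
      · simp [hr]
  obtain ⟨T, hT, h⟩ := key Finset.univ
  convert hT
  refine (extBasis n).ext fun r => ?_
  rw [extUnit_extBasis, h]
  by_cases hr : r = ∅
  · simp [hr]
  · rw [if_neg hr, if_neg]
    simpa [disjoint_iff] using hr

/-- From the vacuum projection, creation operators on the left move the target and annihilation
operators on the right move the source. -/
theorem extUnit_mem {n : ℕ} (e : Fin (2 * n) ≃ Fin n ⊕ Fin n) (s t : Finset (Fin n)) :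
    extUnit s t ∈ cliffSpan e := by
  induction s using Finset.induction_on with
  | insert k s hk ih =>
    obtain ⟨ε, hε⟩ := extBasis_insert hk
    have : extUnit (insert k s) t = ((ε : ℤ) : ℂ) • (creation k * extUnit s t) := by
      refine (extBasis n).ext fun r => ?_
      by_cases hr : r = t <;> simp [extUnit_extBasis, hr, hε]
    rw [this]
    exact Subalgebra.smul_mem _ (mul_mem (creation_mem_cliffSpan e k) ih) _
  | empty =>
    induction t using Finset.induction_on with
    | empty => exact extUnit_empty_mem e
    | insert k t hk ih =>
      obtain ⟨ε, hε⟩ := extBasis_insert hk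
      have : extUnit ∅ (insert k t) = ((ε : ℤ) : ℂ) • (extUnit ∅ t * annihilation k) := by
        refine (extBasis n).ext fun r => ?_
        rw [extUnit_extBasis, LinearMap.smul_apply, Module.End.mul_apply]
        by_cases hr : k ∈ r
        · obtain ⟨δ, hδ⟩ := extBasis_insert (Finset.notMem_erase k r)
          rw [Finset.insert_erase hr] at hδ
          rw [hδ, map_smul, annihilation_creation_extBasis (Finset.notMem_erase k r), map_smul,
            extUnit_extBasis]
          by_cases hrt : r = insert k t
          · subst hrt
            rw [Finset.erase_insert hk] at hδ ⊢
            -- Both signs relate the same two nonzero vectors but come from separate existence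
            -- statements, so their equality has to be derived.
            have : ε = δ := by
              have h2 := hε.symm.trans hδ
              have h0 : creation k (extBasis n t) ≠ 0 := by
                intro h0
                rw [h0, smul_zero] at hε
                exact (extBasis n).ne_zero _ hε
              have := smul_left_injective ℂ h0 h2
              exact Units.ext (by exact_mod_cast this)
            subst this
            simp [units_smul_smul]
          · have : r.erase k ≠ t := by
              rintro rfl
              exact hrt (Finset.insert_erase hr).symm
            simp [hrt, this]
        · rw [annihilation_extBasis_of_notMem hr, map_zero, smul_zero, if_neg]
          rintro rfl
          simp at hr
      rw [this]
      exact Subalgebra.smul_mem _ (mul_mem ih (annihilation_mem_cliffSpan e k)) _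

theorem cliffSpan_eq_top {n : ℕ} (e : Fin (2 * n) ≃ Fin n ⊕ Fin n) : cliffSpan e = ⊤ := by
  refine eq_top_iff.mpr fun T _ => ?_
  have : T = ∑ t, ∑ s, (extBasis n).repr (T (extBasis n t)) s • extUnit s t := by
    refine (extBasis n).ext fun r => ?_
    simp only [LinearMap.sum_apply, LinearMap.smul_apply, extUnit_extBasis, smul_ite, smul_zero]
    rw [Finset.sum_comm]
    simp [(extBasis n).sum_repr]
  rw [this]
  exact sum_mem fun t _ => sum_mem fun s _ => Subalgebra.smul_mem _ (extUnit_mem e s t) _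

/-- The complexification of the Clifford action, as a real linear map. -/
noncomputable def cliffComplex {n : ℕ} (e : Fin (2 * n) ≃ Fin n ⊕ Fin n) :
    Cliff (2 * n) × Cliff (2 * n) →ₗ[ℝ] Module.End ℂ (ExtAlg n) :=
  (cliffAction e).toLinearMap.coprod
    ((LinearMap.lsmul ℂ (Module.End ℂ (ExtAlg n)) Complex.I).restrictScalars ℝ ∘ₗ
      (cliffAction e).toLinearMap)

theorem cliffComplex_apply {n : ℕ} (e : Fin (2 * n) ≃ Fin n ⊕ Fin n) (x y : Cliff (2 * n)) :
    cliffComplex e (x, y) = cliffAction e x + Complex.I • cliffAction e y := rfl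

theorem cliffComplex_surjective {n : ℕ} (e : Fin (2 * n) ≃ Fin n ⊕ Fin n) :
    Function.Surjective (cliffComplex e) := by
  intro T
  have : T ∈ cliffSpan e := cliffSpan_eq_top e ▸ Algebra.mem_top
  obtain ⟨x, y, h⟩ := this
  exact ⟨(x, y), h.symm⟩

/-- A basis of the Clifford algebra, indexed by the subsets of the standard basis. -/
noncomputable def cliffBasis (m : ℕ) : Module.Basis (Finset (Fin m)) ℝ (Cliff m) :=
  ((EuclideanSpace.basisFun (Fin m) ℝ).toBasis.ExteriorAlgebra).map
    (CliffordAlgebra.equivExterior (cliffForm m)).symm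

instance cliffFinite (m : ℕ) : FiniteDimensional ℝ (Cliff m) := (cliffBasis m).finiteDimensional_of_finite

/-- The real dimensions agree: 2 · 2^(2n) on the left and 2 · (2^n)² on the right. -/
theorem cliffComplex_injective {n : ℕ} (e : Fin (2 * n) ≃ Fin n ⊕ Fin n) :
    Function.Injective (cliffComplex e) := by
  refine (LinearMap.injective_iff_surjective_of_finrank_eq_finrank ?_).mpr
    (cliffComplex_surjective e)
  rw [Module.finrank_prod, Module.finrank_eq_card_basis (cliffBasis (2 * n)),
    ← Module.finrank_mul_finrank ℝ ℂ, Complex.finrank_real_complex, Module.finrank_linearMap,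
    Module.finrank_eq_card_basis (extBasis n)]
  simp
  ring

theorem cliffAction_injective {n : ℕ} (e : Fin (2 * n) ≃ Fin n ⊕ Fin n) :
    Function.Injective (cliffAction e) := by
  intro x y h
  have : cliffComplex e (x, 0) = cliffComplex e (y, 0) := by simp [cliffComplex_apply, h]
  exact congrArg Prod.fst (cliffComplex_injective e this)

-- Commuting with vectors means commuting with the whole complex endomorphism algebra, so z acts as
-- a complex scalar c. Uniqueness of the decomposition x + iy then gives z = Re c.
open CliffordAlgebra in
theorem cliff_central {n : ℕ} (e : Fin (2 * n) ≃ Fin n ⊕ Fin n) {z : Cliff (2 * n)}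
    (hz : ∀ v, z * ι (cliffForm (2 * n)) v = ι (cliffForm (2 * n)) v * z) :
    ∃ r : ℝ, z = algebraMap ℝ (Cliff (2 * n)) r := by
  have hz' : ∀ x, z * x = x * z := fun x => by
    induction x using CliffordAlgebra.induction with
    | algebraMap r => exact (Algebra.commutes r z).symm
    | ι v => exact hz v
    | mul x y hx hy => rw [← mul_assoc, hx, mul_assoc, hy, mul_assoc]
    | add x y hx hy => rw [mul_add, add_mul, hx, hy]
  have hT : cliffAction e z ∈ Subalgebra.center ℂ (Module.End ℂ (ExtAlg n)) := by
    rw [Subalgebra.mem_center_iff]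
    intro T
    obtain ⟨⟨x, y⟩, rfl⟩ := cliffComplex_surjective e T
    rw [cliffComplex_apply, add_mul, mul_add, smul_mul_assoc, mul_smul_comm, ← map_mul, ← map_mul,
      ← map_mul, ← map_mul, hz', hz']
  rw [Algebra.IsCentral.center_eq_bot, Algebra.mem_bot] at hT
  obtain ⟨c, hc⟩ := hT
  refine ⟨c.re, ?_⟩
  have h1 : cliffComplex e (z, 0) = cliffComplex e (algebraMap ℝ _ c.re, algebraMap ℝ _ c.im) := by
    have hr : ∀ r : ℝ, algebraMap ℝ (Module.End ℂ (ExtAlg n)) r =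
      algebraMap ℂ (Module.End ℂ (ExtAlg n)) (r : ℂ) := fun _ => rfl
    rw [cliffComplex_apply, cliffComplex_apply, map_zero, smul_zero, add_zero, ← hc,
      AlgHom.commutes, AlgHom.commutes, hr, hr, Algebra.smul_def, ← map_mul, ← map_add, mul_comm,
      Complex.re_add_im]
  exact congrArg Prod.fst (cliffComplex_injective e h1)

/-! ### Orthogonal transformations and membership in the spin group -/

open CliffordAlgebra

theorem cliffForm_apply {m : ℕ} (v : EuclideanSpace ℝ (Fin m)) :
    cliffForm m v = -(‖v‖ ^ 2) := by
  simp [cliffForm]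

theorem cliffForm_polar {m : ℕ} (v w : EuclideanSpace ℝ (Fin m)) :
    QuadraticMap.polar (cliffForm m) v w = -(2 * ⟪v, w⟫_ℝ) := by
  rw [QuadraticMap.polar, cliffForm_apply, cliffForm_apply, cliffForm_apply, norm_add_sq_real]
  ring

theorem cliff_ι_injective (m : ℕ) : Function.Injective (ι (cliffForm m)) := by
  intro v w h
  have h1 := congrArg (equivExterior (cliffForm m)) h
  have key : ∀ v, equivExterior (cliffForm m) (ι (cliffForm m) v) = ExteriorAlgebra.ι ℝ v :=
    fun v => changeForm_ι changeForm.associated_neg_proof v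
  rw [key, key] at h1
  exact (ExteriorAlgebra.ι_inj ℝ v w).mp h1

theorem mul_eq_involute_mul_of_anticomm {m : ℕ} {z : Cliff m}
    (hz : ∀ v, z * ι (cliffForm m) v = -(ι (cliffForm m) v * z)) (x : Cliff m) :
    z * x = involute x * z := by
  induction x using CliffordAlgebra.induction with
  | algebraMap r => rw [AlgHom.commutes, Algebra.commutes]
  | ι v => rw [hz, involute_ι, neg_mul]
  | mul x y hx hy => rw [← mul_assoc, hx, mul_assoc, hy, map_mul, mul_assoc]
  | add x y hx hy => rw [mul_add, map_add, add_mul, hx, hy]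

theorem ι_unit_mem_lipschitzGroup {m : ℕ} {v : EuclideanSpace ℝ (Fin m)} (hv : v ≠ 0) :
    ∃ y : (Cliff m)ˣ, (y : Cliff m) = ι (cliffForm m) v ∧ y ∈ lipschitzGroup (cliffForm m) := by
  have h : IsUnit (ι (cliffForm m) v) := by
    apply isUnit_ι_of_isUnit
    rw [cliffForm_apply, isUnit_iff_ne_zero]
    simpa using hv
  obtain ⟨y, hy⟩ := h
  exact ⟨y, hy, Subgroup.subset_closure ⟨v, hy.symm⟩⟩

/-- From vw + wv = -2⟨v, w⟩ and v² = -‖v‖²: conjugation by v is minus the reflection in the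
hyperplane orthogonal to v. This is why a sign accompanies each reflection below. -/
theorem ι_mul_ι_reflection {m : ℕ} {v : EuclideanSpace ℝ (Fin m)} (hv : v ≠ 0)
    (w : EuclideanSpace ℝ (Fin m)) :
    ι (cliffForm m) v * ι (cliffForm m) w =
      -(ι (cliffForm m) ((ℝ ∙ v)ᗮ.reflection w) * ι (cliffForm m) v) := by
  have hv' : ‖v‖ ^ 2 ≠ 0 := by simpa using hv
  have h : (ℝ ∙ v)ᗮ.reflection w = w - (2 * (⟪v, w⟫_ℝ / ‖v‖ ^ 2)) • v := by
    rw [Submodule.reflection_orthogonal_apply, Submodule.reflection_singleton_apply, neg_sub,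
      two_smul, ← add_smul, two_mul]
    rfl
  rw [h, ι_mul_ι_comm, cliffForm_polar, map_sub, map_smul, sub_mul, smul_mul_assoc, ι_sq_scalar,
    cliffForm_apply, Algebra.smul_def, ← map_mul (algebraMap ℝ (Cliff m))]
  have h' : 2 * (⟪v, w⟫_ℝ / ‖v‖ ^ 2) * -(‖v‖ ^ 2) = -(2 * ⟪v, w⟫_ℝ) := by
    field_simp
  rw [h', neg_sub]

/-- Every orthogonal transformation is induced by an element of the Lipschitz group. -/
theorem exists_lipschitz_of_isometry {m : ℕ}
    (f : EuclideanSpace ℝ (Fin m) ≃ₗᵢ[ℝ] EuclideanSpace ℝ (Fin m)) :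
    ∃ ε : ℤˣ, ∃ y ∈ lipschitzGroup (cliffForm m), involute (y : Cliff m) = ε • (y : Cliff m) ∧
      ∀ v, (y : Cliff m) * ι (cliffForm m) v = ε • (ι (cliffForm m) (f v) * y) := by
  -- Cartan–Dieudonné: the orthogonal group is generated by reflections. The single sign ε records
  -- both the parity of y and the twist in its conjugation action, and both are multiplicative.
  have hf : f ∈ Subgroup.closure (Set.range fun v : EuclideanSpace ℝ (Fin m) =>
      (ℝ ∙ v)ᗮ.reflection) := by
    rw [LinearIsometryEquiv.reflections_generate]
    exact Subgroup.mem_top f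
  induction hf using Subgroup.closure_induction with
  | mem f hf =>
    obtain ⟨v, rfl⟩ := hf
    by_cases hv : v = 0
    · subst hv
      exact ⟨1, 1, one_mem _, by simp, fun v => by simp [Submodule.reflection_mem_subspace_eq_self]⟩
    · obtain ⟨y, hy, hmem⟩ := ι_unit_mem_lipschitzGroup hv
      refine ⟨-1, y, hmem, by simp [hy], fun w => ?_⟩
      rw [hy, ι_mul_ι_reflection hv]
      simp
  | one => exact ⟨1, 1, one_mem _, by simp, fun v => by simp⟩
  | mul f g _ _ hf hg =>
    obtain ⟨ε, y, hy, hy1, hy2⟩ := hf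
    obtain ⟨δ, z, hz, hz1, hz2⟩ := hg
    refine ⟨ε * δ, y * z, mul_mem hy hz, ?_, fun v => ?_⟩
    · rw [Units.val_mul, map_mul, hy1, hz1, smul_mul_smul_comm]
    · rw [Units.val_mul, mul_assoc, hz2, mul_smul_comm, ← mul_assoc, hy2, smul_mul_assoc,
        smul_smul, mul_comm δ ε, mul_assoc]
      rfl
  | inv f _ hf =>
    obtain ⟨ε, y, hy, hy1, hy2⟩ := hf
    refine ⟨ε, y⁻¹, inv_mem hy, ?_, fun v => ?_⟩
    · have h1 : (ε • (y : Cliff m)) * involute ((y⁻¹ : (Cliff m)ˣ) : Cliff m) = 1 := by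
        rw [← hy1, ← map_mul, Units.mul_inv, map_one]
      rw [smul_mul_assoc] at h1
      have h2 : (y : Cliff m) * involute ((y⁻¹ : (Cliff m)ˣ) : Cliff m) = ε • 1 := by
        rw [← h1, smul_smul, Int.units_mul_self, one_smul]
      have h3 := congrArg (fun t => ((y⁻¹ : (Cliff m)ˣ) : Cliff m) * t) h2
      simpa using h3
    · have h1 := hy2 (f⁻¹ v)
      have h2 : f (f⁻¹ v) = v := f.apply_symm_apply v
      rw [h2] at h1
      have h3 := congrArg (fun t => ((y⁻¹ : (Cliff m)ˣ) : Cliff m) * t * ((y⁻¹ : (Cliff m)ˣ) : Cliff m)) h1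
      simp only [mul_smul_comm, smul_mul_assoc, mul_assoc, Units.mul_inv, mul_one,
        Units.inv_mul_cancel_left] at h3
      rw [h3, smul_smul, Int.units_mul_self, one_smul]

theorem mem_even_of_involute_eq {m : ℕ} {x : Cliff m} (hx : involute x = x) :
    x ∈ CliffordAlgebra.even (cliffForm m) := by
  have h : x ∈ evenOdd (cliffForm m) 0 ⊔ evenOdd (cliffForm m) 1 := by
    rw [(evenOdd_isCompl (cliffForm m)).sup_eq_top]
    exact Submodule.mem_top
  obtain ⟨a, ha, b, hb, rfl⟩ := Submodule.mem_sup.mp h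
  rw [map_add, involute_eq_of_mem_even ha, involute_eq_of_mem_odd hb] at hx
  have hb0 : (2 : ℝ) • b = 0 := by
    have h1 := add_left_cancel hx
    rw [two_smul]
    nth_rw 1 [← h1]
    exact neg_add_cancel b
  rw [smul_eq_zero_iff_right two_ne_zero] at hb0
  rw [hb0, add_zero]
  exact ha

/-- A nonzero scalar is the quotient of the two vectors rv and v. -/
theorem algebraMap_unit_mem_lipschitzGroup {m : ℕ} (v : EuclideanSpace ℝ (Fin m)) (hv : v ≠ 0)
    {z : (Cliff m)ˣ} {r : ℝ} (hz : (z : Cliff m) = algebraMap ℝ (Cliff m) r) (hr : r ≠ 0) :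
    z ∈ lipschitzGroup (cliffForm m) := by
  obtain ⟨y, hy, hmem⟩ := ι_unit_mem_lipschitzGroup hv
  obtain ⟨w, hw, hmem'⟩ := ι_unit_mem_lipschitzGroup (smul_ne_zero hr hv)
  have : z = w * y⁻¹ := by
    rw [eq_mul_inv_iff_mul_eq]
    ext
    rw [Units.val_mul, hz, hy, hw, map_smul, Algebra.smul_def]
  rw [this]
  exact mul_mem hmem' (inv_mem hmem)

/-- An even unitary element of the Clifford algebra whose conjugation action preserves the space
of vectors belongs to the spin group. -/
theorem mem_spinGroup_of_conj {n : ℕ} (hn : n ≠ 0) (e : Fin (2 * n) ≃ Fin n ⊕ Fin n)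
    {x : Cliff (2 * n)} (hx : involute x = x) (hu : x ∈ unitary (Cliff (2 * n)))
    (hv : ∀ v, ∃ w, x * ι (cliffForm (2 * n)) v = ι (cliffForm (2 * n)) w * x) :
    x ∈ spinGroup (cliffForm (2 * n)) := by
  have : Nontrivial (Cliff (2 * n)) := inferInstance
  obtain ⟨hu1, hu2⟩ := hu
  let X : (Cliff (2 * n))ˣ := ⟨x, star x, hu2, hu1⟩
  choose f hf using hv
  have hinj : ∀ {a b}, ι (cliffForm (2 * n)) a * x = ι (cliffForm (2 * n)) b * x → a = b := by
    intro a b h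
    exact cliff_ι_injective _ (X.isUnit.mul_right_cancel h)
  -- The vector chosen for each v is unique, as x is invertible and vectors embed in the Clifford
  -- algebra, so the choice is automatically linear. Squaring shows that it preserves norms.
  let g : EuclideanSpace ℝ (Fin (2 * n)) →ₗ[ℝ] EuclideanSpace ℝ (Fin (2 * n)) :=
    { toFun := f
      map_add' := fun a b => hinj (by rw [← hf, map_add, map_add, mul_add, add_mul, hf, hf])
      map_smul' := fun r a => hinj (by
        rw [← hf, map_smul, map_smul, mul_smul_comm, smul_mul_assoc, hf, RingHom.id_apply]) }
  have hnorm : ∀ v, ‖g v‖ = ‖v‖ := fun v => by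
    have h1 : algebraMap ℝ (Cliff (2 * n)) (cliffForm _ v) * x =
        algebraMap ℝ (Cliff (2 * n)) (cliffForm _ (f v)) * x := by
      rw [Algebra.commutes, ← ι_sq_scalar, ← mul_assoc, hf, mul_assoc, hf, ← mul_assoc, ι_sq_scalar]
    have h2 := X.isUnit.mul_right_cancel h1
    have h3 := (algebraMap ℝ (Cliff (2 * n))).injective h2
    rw [cliffForm_apply, cliffForm_apply, neg_inj] at h3
    exact ((sq_eq_sq₀ (norm_nonneg _) (norm_nonneg _)).mp h3).symm
  let G : EuclideanSpace ℝ (Fin (2 * n)) ≃ₗᵢ[ℝ] EuclideanSpace ℝ (Fin (2 * n)) :=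
    LinearIsometry.toLinearIsometryEquiv ⟨g, hnorm⟩ rfl
  obtain ⟨ε, y, hy, hy1, hy2⟩ := exists_lipschitz_of_isometry G
  -- The discrepancy between x and the Lipschitz element y inducing the same isometry: z commutes or
  -- anticommutes with every vector, according to ε.
  let z : (Cliff (2 * n))ˣ := y⁻¹ * X
  have hz0 : (y : Cliff (2 * n)) * z = x := by simp [z, X]
  have hz1 : involute (z : Cliff (2 * n)) = ε • (z : Cliff (2 * n)) := by
    have h1 := congrArg involute hz0
    rw [map_mul, hy1, hx, smul_mul_assoc, ← hz0] at h1
    have h2 : (y : Cliff (2 * n)) * involute (z : Cliff (2 * n)) = y * (ε • (z : Cliff (2 * n))) := by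
      rw [mul_smul_comm, ← h1, smul_smul, Int.units_mul_self, one_smul]
    exact y.isUnit.mul_left_cancel h2
  have hz2 : ∀ v, (z : Cliff (2 * n)) * ι (cliffForm (2 * n)) v =
      ε • (ι (cliffForm (2 * n)) v * z) := fun v => by
    apply y.isUnit.mul_left_cancel
    rw [← mul_assoc, hz0, hf, mul_smul_comm, ← mul_assoc, hy2, smul_mul_assoc, smul_smul,
      Int.units_mul_self, one_smul, mul_assoc, hz0]
    rfl
  have hzmem : z ∈ lipschitzGroup (cliffForm (2 * n)) := by
    rcases Int.units_eq_one_or ε with rfl | rfl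
    · obtain ⟨r, hr⟩ := cliff_central e (z := z) fun v => by rw [hz2, one_smul]
      -- A nonzero vector is needed to write the scalar as a quotient of vectors; it exists because
      -- n ≠ 0.
      have : Nonempty (Fin (2 * n)) := ⟨⟨0, by omega⟩⟩
      obtain ⟨v, hv⟩ := exists_ne (0 : EuclideanSpace ℝ (Fin (2 * n)))
      refine algebraMap_unit_mem_lipschitzGroup v hv hr ?_
      rintro rfl
      rw [map_zero] at hr
      exact z.ne_zero hr
    -- For ε = -1, z is odd and anticommutes with all vectors. Moving z past itself gives z² = -z²,
    -- so z² = 0, although z is a unit.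
    · exfalso
      have h1 := mul_eq_involute_mul_of_anticomm (z := (z : Cliff (2 * n)))
        (fun v => by rw [hz2, Units.neg_smul, one_smul]) z
      rw [hz1] at h1
      simp only [Units.neg_smul, one_smul, neg_mul] at h1
      have h2 : (2 : ℝ) • ((z : Cliff (2 * n)) * z) = 0 := by
        rw [two_smul]
        nth_rw 1 [h1]
        exact neg_add_cancel _
      rw [smul_eq_zero_iff_right two_ne_zero] at h2
      simp at h2
  refine ⟨⟨⟨X, ?_, rfl⟩, hu1, hu2⟩, mem_even_of_involute_eq hx⟩
  have : X = y * z := by simp [z]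
  rw [this]
  exact mul_mem hy hzmem

theorem spinGroup_conj_ι {m : ℕ} (x : Spin m) (v : EuclideanSpace ℝ (Fin m)) :
    ∃ w, (x : Cliff m) * ι (cliffForm m) v = ι (cliffForm m) w * x := by
  have hx : ((spinGroup.toUnits x : (Cliff m)ˣ) : Cliff m) ∈ spinGroup (cliffForm m) := x.2
  obtain ⟨w, hw⟩ := spinGroup.conjAct_smul_ι_mem_range_ι hx v
  refine ⟨w, ?_⟩
  rw [hw, ConjAct.units_smul_def, ConjAct.ofConjAct_toConjAct]
  exact (Units.inv_mul_cancel_right _ (spinGroup.toUnits x)).symm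

/-! ### Matrix conditions describing Clifford elements and the spin group -/

section General

variable {n : ℕ} {I : Type*} [Fintype I] [DecidableEq I]

/-- The Clifford action on `Λ ℂⁿ`, written as matrices in an orthonormal basis. -/
noncomputable def cliffMatrix (b : OrthonormalBasis I ℂ (ExtAlg n)) (e : Fin (2 * n) ≃ Fin n ⊕ Fin n) :
    Cliff (2 * n) →ₐ[ℝ] Matrix I I ℂ :=
  ((AlgHomClass.toAlgHom (LinearMap.toMatrixOrthonormal b)).restrictScalars ℝ).comp (cliffAction e)

theorem cliffMatrix_eq (b : OrthonormalBasis I ℂ (ExtAlg n)) (e : Fin (2 * n) ≃ Fin n ⊕ Fin n)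
    (x : Cliff (2 * n)) :
    cliffMatrix b e x = LinearMap.toMatrixOrthonormal b (cliffAction e x) := rfl

theorem cliffMatrix_injective (b : OrthonormalBasis I ℂ (ExtAlg n))
    (e : Fin (2 * n) ≃ Fin n ⊕ Fin n) : Function.Injective (cliffMatrix b e) :=
  (LinearMap.toMatrixOrthonormal b).injective.comp (cliffAction_injective e)

theorem cliffMatrix_star (b : OrthonormalBasis I ℂ (ExtAlg n)) (e : Fin (2 * n) ≃ Fin n ⊕ Fin n)
    (x : Cliff (2 * n)) : cliffMatrix b e (star x) = (cliffMatrix b e x).conjTranspose := by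
  rw [cliffMatrix_eq, cliffAction_star, map_star]
  rfl

theorem cliffAction_basis (b : OrthonormalBasis I ℂ (ExtAlg n)) (e : Fin (2 * n) ≃ Fin n ⊕ Fin n)
    (x : Cliff (2 * n)) (j : I) : cliffAction e x (b j) = ∑ i, cliffMatrix b e x i j • b i := by
  simp only [cliffMatrix_eq, LinearMap.toMatrixOrthonormal_apply_apply]
  exact (b.sum_repr' _).symm

theorem cliffMatrix_eq_of_basis (b : OrthonormalBasis I ℂ (ExtAlg n))
    (e : Fin (2 * n) ≃ Fin n ⊕ Fin n) {x : Cliff (2 * n)} {M : Matrix I I ℂ}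
    (h : ∀ j, cliffAction e x (b j) = ∑ i, M i j • b i) : cliffMatrix b e x = M := by
  ext i j
  rw [cliffMatrix_eq, LinearMap.toMatrixOrthonormal_apply_apply, h, inner_sum]
  simp [inner_smul_right, orthonormal_iff_ite.mp b.orthonormal]

theorem exists_cliffMatrix_add (b : OrthonormalBasis I ℂ (ExtAlg n))
    (e : Fin (2 * n) ≃ Fin n ⊕ Fin n) (T : Matrix I I ℂ) :
    ∃ x y, T = cliffMatrix b e x + Complex.I • cliffMatrix b e y := by
  obtain ⟨⟨x, y⟩, h⟩ := cliffComplex_surjective e ((LinearMap.toMatrixOrthonormal b).symm T)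
  refine ⟨x, y, ?_⟩
  rw [cliffMatrix_eq, cliffMatrix_eq, ← map_smul, ← map_add, ← cliffComplex_apply, h,
    StarAlgEquiv.apply_symm_apply]

/-- The map ψ ↦ J ψ̄ is antilinear. Commuting with a real algebra can be tested on generators, and
real scalars are unaffected by conjugation. -/
theorem cliffMatrix_conj (b : OrthonormalBasis I ℂ (ExtAlg n)) (e : Fin (2 * n) ≃ Fin n ⊕ Fin n)
    {J : Matrix I I ℂ}
    (hJ : ∀ v, J * (cliffMatrix b e (ι _ v)).map (starRingEnd ℂ) = cliffMatrix b e (ι _ v) * J)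
    (x : Cliff (2 * n)) :
    J * (cliffMatrix b e x).map (starRingEnd ℂ) = cliffMatrix b e x * J := by
  induction x using CliffordAlgebra.induction with
  | algebraMap r =>
    rw [AlgHom.commutes, Algebra.commutes]
    congr 1
    ext i j
    by_cases h : i = j <;> simp [Matrix.algebraMap_matrix_apply, h]
  | ι v => exact hJ v
  | mul x y hx hy => rw [map_mul, Matrix.map_mul, ← mul_assoc, hx, mul_assoc, hy, mul_assoc]
  | add x y hx hy =>
    rw [map_add, Matrix.map_add _ (map_add _), mul_add, hx, hy, add_mul]

theorem cliffMatrix_involute (b : OrthonormalBasis I ℂ (ExtAlg n))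
    (e : Fin (2 * n) ≃ Fin n ⊕ Fin n) {P : Matrix I I ℂ}
    (hP : ∀ v, P * cliffMatrix b e (ι _ v) = -(cliffMatrix b e (ι _ v) * P))
    (x : Cliff (2 * n)) :
    P * cliffMatrix b e x = cliffMatrix b e (involute x) * P := by
  induction x using CliffordAlgebra.induction with
  | algebraMap r =>
    rw [AlgHom.commutes, AlgHom.commutes, AlgHom.commutes, Algebra.commutes r P]
  | ι v => rw [hP, involute_ι, map_neg, neg_mul]
  | mul x y hx hy => rw [map_mul, map_mul, ← mul_assoc, hx, mul_assoc, hy, map_mul, mul_assoc]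
  | add x y hx hy => simp only [map_add, mul_add, add_mul, hx, hy]

/-- The matrices commuting with the antilinear structure `J` are those of Clifford elements. -/
theorem exists_cliffMatrix_eq (b : OrthonormalBasis I ℂ (ExtAlg n))
    (e : Fin (2 * n) ≃ Fin n ⊕ Fin n) {J : Matrix I I ℂ} (hJu : IsUnit J)
    (hJ : ∀ v, J * (cliffMatrix b e (ι _ v)).map (starRingEnd ℂ) = cliffMatrix b e (ι _ v) * J)
    {T : Matrix I I ℂ} (hT : J * T.map (starRingEnd ℂ) = T * J) : ∃ x, cliffMatrix b e x = T := by
  obtain ⟨x, y, rfl⟩ := exists_cliffMatrix_add b e T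
  have h1 : (Complex.I • cliffMatrix b e y).map (starRingEnd ℂ) =
      -(Complex.I • (cliffMatrix b e y).map (starRingEnd ℂ)) := by
    ext i j
    simp
  rw [Matrix.map_add _ (map_add _), h1, mul_add, cliffMatrix_conj b e hJ, mul_neg, mul_smul_comm,
    cliffMatrix_conj b e hJ, add_mul, smul_mul_assoc] at hT
  -- Writing T = x + iy, passing the antilinear operator across T changes the sign of the iy term
  -- only, so equality kills yJ.
  have h2 : (2 * Complex.I) • (cliffMatrix b e y * J) = 0 := by
    have h3 := add_left_cancel hT
    rw [two_mul, add_smul]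
    nth_rw 1 [← h3]
    exact neg_add_cancel _
  rw [smul_eq_zero_iff_right (by simp)] at h2
  have h3 : cliffMatrix b e y = 0 := hJu.mul_left_eq_zero.mp h2
  exact ⟨x, by rw [h3, smul_zero, add_zero]⟩

/-- Each hypothesis on T answers one requirement on a spin element: J makes T a real Clifford
element, P makes it even, and the last two give the unitarity and the conjugation condition of
`mem_spinGroup_of_conj`. -/
theorem exists_spin_cliffMatrix_eq (hn : n ≠ 0) (b : OrthonormalBasis I ℂ (ExtAlg n))
    (e : Fin (2 * n) ≃ Fin n ⊕ Fin n) {J P T : Matrix I I ℂ} (hJu : IsUnit J) (hPu : IsUnit P)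
    (hJ : ∀ v, J * (cliffMatrix b e (ι _ v)).map (starRingEnd ℂ) = cliffMatrix b e (ι _ v) * J)
    (hP : ∀ v, P * cliffMatrix b e (ι _ v) = -(cliffMatrix b e (ι _ v) * P))
    (hT : J * T.map (starRingEnd ℂ) = T * J) (hTP : P * T = T * P)
    (hTu : T ∈ Matrix.unitaryGroup I ℂ)
    (hTv : ∀ v, ∃ w, T * cliffMatrix b e (ι _ v) = cliffMatrix b e (ι _ w) * T) :
    ∃ x : Spin (2 * n), cliffMatrix b e x = T := by
  obtain ⟨x, rfl⟩ := exists_cliffMatrix_eq b e hJu hJ hT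
  refine ⟨⟨x, mem_spinGroup_of_conj hn e ?_ ⟨?_, ?_⟩ fun v => ?_⟩, rfl⟩
  · apply cliffMatrix_injective b e
    apply hPu.mul_right_cancel
    rw [← hTP, cliffMatrix_involute b e hP]
  · apply cliffMatrix_injective b e
    rw [map_mul, cliffMatrix_star, map_one]
    exact Matrix.mem_unitaryGroup_iff'.mp hTu
  · apply cliffMatrix_injective b e
    rw [map_mul, cliffMatrix_star, map_one]
    exact Matrix.mem_unitaryGroup_iff.mp hTu
  · obtain ⟨w, hw⟩ := hTv v
    refine ⟨w, cliffMatrix_injective b e ?_⟩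
    rw [map_mul, map_mul, hw]

theorem cliffMatrix_spin_mem_unitary (b : OrthonormalBasis I ℂ (ExtAlg n))
    (e : Fin (2 * n) ≃ Fin n ⊕ Fin n) (x : Spin (2 * n)) :
    cliffMatrix b e x ∈ Matrix.unitaryGroup I ℂ := by
  rw [Matrix.mem_unitaryGroup_iff, Matrix.star_eq_conjTranspose, ← cliffMatrix_star, ← map_mul,
    spinGroup.mul_star_self_of_mem x.2, map_one]

theorem cliffMatrix_spin_conj (b : OrthonormalBasis I ℂ (ExtAlg n))
    (e : Fin (2 * n) ≃ Fin n ⊕ Fin n) (x : Spin (2 * n)) (v : EuclideanSpace ℝ (Fin (2 * n))) :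
    ∃ w, cliffMatrix b e x * cliffMatrix b e (ι _ v) =
      cliffMatrix b e (ι _ w) * cliffMatrix b e x := by
  obtain ⟨w, hw⟩ := spinGroup_conj_ι x v
  exact ⟨w, by rw [← map_mul, hw, map_mul]⟩

/-- The complex coordinates in which a real vector acts as `∑ j, ζ_j a_j - conj ζ_j a_j*`. -/
noncomputable def diracCoord (e : Fin (2 * n) ≃ Fin n ⊕ Fin n) (v : EuclideanSpace ℝ (Fin (2 * n)))
    (j : Fin n) : ℂ := v (e.symm (.inr j)) + v (e.symm (.inl j)) * Complex.I

theorem diracCoord_surjective (e : Fin (2 * n) ≃ Fin n ⊕ Fin n) :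
    Function.Surjective (diracCoord e) := by
  intro z
  refine ⟨WithLp.toLp 2 fun k => Sum.elim (fun j => (z j).im) (fun j => (z j).re) (e k), ?_⟩
  ext j
  simp [diracCoord]

theorem cliffAction_ι_apply (e : Fin (2 * n) ≃ Fin n ⊕ Fin n) (v : EuclideanSpace ℝ (Fin (2 * n)))
    (ψ : ExtAlg n) : cliffAction e (ι _ v) ψ =
      ∑ j, (diracCoord e v j • annihilation j ψ -
        (starRingEnd ℂ) (diracCoord e v j) • (ext1 j * ψ)) := by
  have h : gammaMap e v = ∑ k, ((v k : ℝ) : ℂ) • gammaOp (e k) := rfl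
  rw [cliffAction_ι, h, ← e.symm.sum_comp, Fintype.sum_sum_type, ← Finset.sum_add_distrib,
    LinearMap.sum_apply]
  refine Finset.sum_congr rfl fun j _ => ?_
  simp only [Equiv.apply_symm_apply, gammaOp, creation, LinearMap.add_apply, LinearMap.smul_apply,
    LinearMap.sub_apply, LinearMap.mulLeft_apply, diracCoord, map_add, map_mul, Complex.conj_ofReal,
    Complex.conj_I]
  module

end General

/-! ### The explicit matrices of vectors on Λ ℂ² and Λ ℂ³ -/

theorem annihilation_ext1_mul {n : ℕ} (i j : Fin n) (ψ : ExtAlg n) :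
    annihilation i (ext1 j * ψ) = (if i = j then ψ else 0) - ext1 j * annihilation i ψ :=
  annihilation_creation i j ψ

theorem annihilation_ext1 {n : ℕ} (i j : Fin n) :
    annihilation i (ext1 j) = if i = j then 1 else 0 := by
  have := annihilation_ext1_mul i j 1
  rwa [mul_one, annihilation_one, mul_zero, sub_zero] at this

theorem ext1_mul_self {n : ℕ} (j : Fin n) : (ext1 j * ext1 j : ExtAlg n) = 0 :=
  ExteriorAlgebra.ι_sq_zero _

theorem ext1_mul_swap {n : ℕ} (i j : Fin n) : (ext1 i * ext1 j : ExtAlg n) = -(ext1 j * ext1 i) :=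
  eq_neg_of_add_eq_zero_left (ExteriorAlgebra.ι_add_mul_swap _ _)

theorem ext1_mul_self_mul {n : ℕ} (j : Fin n) (ψ : ExtAlg n) : ext1 j * (ext1 j * ψ) = 0 := by
  rw [← mul_assoc, ext1_mul_self, zero_mul]

theorem ext1_mul_swap_mul {n : ℕ} (i j : Fin n) (ψ : ExtAlg n) :
    ext1 i * (ext1 j * ψ) = -(ext1 j * (ext1 i * ψ)) := by
  rw [← mul_assoc, ext1_mul_swap, neg_mul, mul_assoc]

/-- The orthonormal basis `u, d, u ∧ d, 1` of `Λ ℂ²`. -/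
noncomputable def isospinBasis : OrthonormalBasis (Fin 2 ⊕ Fin 2) ℂ (ExtAlg 2) :=
  (EuclideanSpace.basisFun _ ℂ).map isospinOp

theorem isospinBasis_apply (i : Fin 2 ⊕ Fin 2) : isospinBasis i = isospinCode i := by
  simp [isospinBasis, isospinOp, unitaryOfFamily_single]

/-- The orthonormal basis of `Λ ℂ³` adapted to `ℂ⁴ ⊕ ℂ⁴*`. -/
noncomputable def colorBasis : OrthonormalBasis (Color ⊕ Color) ℂ (ExtAlg 3) :=
  (EuclideanSpace.basisFun _ ℂ).map (colorOp (-1))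

theorem colorBasis_apply (i : Color ⊕ Color) : colorBasis i = colorCode (-1) i := by
  simp [colorBasis, colorOp, unitaryOfFamily_single]

/-- The block of a vector in the Clifford matrices of `Λ ℂ²`. -/
noncomputable def isospinBlock (z : Fin 2 → ℂ) : Matrix (Fin 2) (Fin 2) ℂ :=
  !![(starRingEnd ℂ) (z 1), -(starRingEnd ℂ) (z 0); z 0, z 1]

/-- The matrix of the cross product with a vector. -/
def crossMatrix (a : Fin 3 → ℂ) : Matrix (Fin 3) (Fin 3) ℂ :=
  !![0, a 2, -a 1; -a 2, 0, a 0; a 1, -a 0, 0]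

/-- The skew symmetric matrix with given entries. -/
def skew (a b : Fin 3 → ℂ) : Matrix Color Color ℂ :=
  Matrix.fromBlocks (crossMatrix a) (Matrix.of fun i _ => b i) (Matrix.of fun _ i => -b i) 0

/-- The block of a vector in the Clifford matrices of `Λ ℂ³`. -/
noncomputable def colorBlock (z : Fin 3 → ℂ) : Matrix Color Color ℂ := skew (star z) z

theorem cliffMatrix_isospin_ι (e : Fin (2 * 2) ≃ Fin 2 ⊕ Fin 2) (v) :
    cliffMatrix isospinBasis e (ι _ v) = Matrix.fromBlocks 0
      (-(isospinBlock (diracCoord e v)).conjTranspose) (isospinBlock (diracCoord e v)) 0 := by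
  apply cliffMatrix_eq_of_basis
  intro j
  rw [cliffAction_ι_apply]
  generalize diracCoord e v = z
  simp only [isospinBasis_apply, Fintype.sum_sum_type, Fin.sum_univ_two]
  rcases j with j | j <;> fin_cases j <;>
  simp [isospinCode, isospinBlock, annihilation_ext1_mul, annihilation_ext1, annihilation_one,
    ext1_mul_self, ext1_mul_swap 1 0, ext1_mul_self_mul, ext1_mul_swap_mul 1 0] <;> module

/-- The choice ε = -1 in `colorBasis` is what makes the block skew symmetric: contracting r, g, b
gives multiples of 1 = -w̄, against the opposite signs coming from w. -/
theorem cliffMatrix_color_ι (e : Fin (2 * 3) ≃ Fin 3 ⊕ Fin 3) (v) :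
    cliffMatrix colorBasis e (ι _ v) = Matrix.fromBlocks 0
      (-(colorBlock (diracCoord e v)).conjTranspose) (colorBlock (diracCoord e v)) 0 := by
  apply cliffMatrix_eq_of_basis
  intro j
  rw [cliffAction_ι_apply]
  generalize diracCoord e v = z
  simp only [colorBasis_apply, Fintype.sum_sum_type, Fin.sum_univ_three]
  rcases j with (j | j) | (j | j) <;> fin_cases j <;>
  simp [colorCode, colorBlock, skew, crossMatrix, annihilation_ext1_mul, annihilation_ext1,
    annihilation_one, mul_assoc, ext1_mul_swap 2 1, ext1_mul_swap 2 0,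
    ext1_mul_self, ext1_mul_swap 1 0, ext1_mul_self_mul, ext1_mul_swap_mul 1 0,
    ext1_mul_swap_mul 2 0, ext1_mul_swap_mul 2 1] <;> module

/-! ### SU(2) and the symplectic form -/

/-- The standard symplectic matrix of size two. -/
def symp : Matrix (Fin 2) (Fin 2) ℂ := !![0, 1; -1, 0]

theorem mul_symp_mul_transpose (g : Matrix (Fin 2) (Fin 2) ℂ) :
    g * symp * g.transpose = g.det • symp := by
  ext i j
  fin_cases i <;> fin_cases j <;>
    simp [symp, Matrix.mul_apply, Fin.sum_univ_two, Matrix.det_fin_two] <;> ring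

theorem transpose_mul_map_conj {I : Type*} [Fintype I] [DecidableEq I] {g : Matrix I I ℂ}
    (hg : g ∈ Matrix.unitaryGroup I ℂ) : g.transpose * g.map (starRingEnd ℂ) = 1 := by
  have h := Matrix.mem_unitaryGroup_iff'.mp hg
  have h2 := congrArg (fun M => M.map (starRingEnd ℂ)) h
  simp only [Matrix.map_mul] at h2
  rw [Matrix.map_one _ (map_zero _) (map_one _)] at h2
  rw [← h2]
  congr 1
  ext i j
  simp [Matrix.star_apply]

theorem map_conj_mul_transpose {I : Type*} [Fintype I] [DecidableEq I] {g : Matrix I I ℂ}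
    (hg : g ∈ Matrix.unitaryGroup I ℂ) : g.map (starRingEnd ℂ) * g.transpose = 1 :=
  mul_eq_one_comm.mp (transpose_mul_map_conj hg)

/-- For unitary g the conjugate ḡ is inverse to gᵀ, so the condition says that g preserves the area
form, which g scales by det g. -/
theorem symp_mul_conj_iff {g : Matrix (Fin 2) (Fin 2) ℂ}
    (hg : g ∈ Matrix.unitaryGroup (Fin 2) ℂ) :
    symp * g.map (starRingEnd ℂ) = g * symp ↔ g.det = 1 := by
  have h := mul_symp_mul_transpose g
  constructor
  · intro h1
    rw [← h1, mul_assoc, map_conj_mul_transpose hg, mul_one] at h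
    have := congrFun (congrFun h 0) 1
    simpa [symp] using this.symm
  · intro h1
    rw [h1, one_smul] at h
    nth_rw 1 [← h]
    rw [mul_assoc, transpose_mul_map_conj hg, mul_one]

/-- The condition expresses the first row of M through the second, and the second row of a vector
block is its coordinate vector z. -/
theorem exists_isospinBlock_eq {M : Matrix (Fin 2) (Fin 2) ℂ}
    (h : symp * M.map (starRingEnd ℂ) = M * symp) : ∃ z, M = isospinBlock z := by
  refine ⟨M 1, ?_⟩
  have h1 := congrFun (congrFun h 1) 0
  have h2 := congrFun (congrFun h 1) 1
  simp [symp, Matrix.mul_apply, Fin.sum_univ_two] at h1 h2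
  ext i j
  fin_cases i <;> fin_cases j <;> simp [isospinBlock, ← h1, ← h2]

theorem symp_mul_isospinBlock (z : Fin 2 → ℂ) :
    symp * (isospinBlock z).map (starRingEnd ℂ) = isospinBlock z * symp := by
  ext i j
  fin_cases i <;> fin_cases j <;> simp [isospinBlock, symp, Matrix.mul_apply, Fin.sum_univ_two]

/-! ### SU(4) acting on skew symmetric 4 × 4 matrices -/

theorem det_color (M : Matrix Color Color ℂ) :
    M.det = (M.submatrix ![.inl 0, .inl 1, .inl 2, .inr ()]
      ![.inl 0, .inl 1, .inl 2, .inr ()]).det := by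
  let f : Fin 4 → Color := ![.inl 0, .inl 1, .inl 2, .inr ()]
  have hf : Function.Bijective f := by decide
  exact (Matrix.det_submatrix_equiv_self (Equiv.ofBijective f hf) M).symm

/-- Laplace expansion along the first two rows. The 2 × 2 minors match those in
`mul_skew_mul_transpose_apply`, which makes the duality identity below a polynomial check. -/
theorem det_fin_four (M : Matrix (Fin 4) (Fin 4) ℂ) :
    M.det =
      (M 0 0 * M 1 1 - M 0 1 * M 1 0) * (M 2 2 * M 3 3 - M 2 3 * M 3 2) -
      (M 0 0 * M 1 2 - M 0 2 * M 1 0) * (M 2 1 * M 3 3 - M 2 3 * M 3 1) +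
      (M 0 0 * M 1 3 - M 0 3 * M 1 0) * (M 2 1 * M 3 2 - M 2 2 * M 3 1) +
      (M 0 1 * M 1 2 - M 0 2 * M 1 1) * (M 2 0 * M 3 3 - M 2 3 * M 3 0) -
      (M 0 1 * M 1 3 - M 0 3 * M 1 1) * (M 2 0 * M 3 2 - M 2 2 * M 3 0) +
      (M 0 2 * M 1 3 - M 0 3 * M 1 2) * (M 2 0 * M 3 1 - M 2 1 * M 3 0) := by
  rw [Matrix.det_succ_row_zero, Fin.sum_univ_four]
  simp only [Matrix.det_fin_three, Matrix.submatrix_apply]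
  simp [Fin.succAbove, Fin.lt_def]
  ring

theorem mul_skew_mul_transpose_apply (W : Matrix Color Color ℂ) (a b : Fin 3 → ℂ) (i j : Color) :
    (W * skew a b * W.transpose) i j =
      a 0 * (W i (.inl 1) * W j (.inl 2) - W i (.inl 2) * W j (.inl 1)) +
      a 1 * (W i (.inl 2) * W j (.inl 0) - W i (.inl 0) * W j (.inl 2)) +
      a 2 * (W i (.inl 0) * W j (.inl 1) - W i (.inl 1) * W j (.inl 0)) +
      b 0 * (W i (.inl 0) * W j (.inr ()) - W i (.inr ()) * W j (.inl 0)) +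
      b 1 * (W i (.inl 1) * W j (.inr ()) - W i (.inr ()) * W j (.inl 1)) +
      b 2 * (W i (.inl 2) * W j (.inr ()) - W i (.inr ()) * W j (.inl 2)) := by
  simp [skew, crossMatrix, Matrix.mul_apply, Fin.sum_univ_three]
  ring

theorem skew_transpose (a b : Fin 3 → ℂ) : (skew a b).transpose = -skew a b := by
  ext i j
  rcases i with i | i <;> rcases j with j | j <;> fin_cases i <;> fin_cases j <;>
    simp [skew, crossMatrix]

theorem eq_skew_of_transpose {A : Matrix Color Color ℂ} (h : A.transpose = -A) :
    A = skew ![A (.inl 1) (.inl 2), A (.inl 2) (.inl 0), A (.inl 0) (.inl 1)]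
      fun i => A (.inl i) (.inr ()) := by
  have h1 : ∀ i j, A j i = -A i j := fun i j => congrFun (congrFun h i) j
  have h2 : ∀ i, A i i = 0 := fun i => self_eq_neg.mp (h1 i i)
  ext i j
  rcases i with i | i <;> rcases j with j | j <;> fin_cases i <;> fin_cases j <;>
    simp [skew, crossMatrix, h2]
  · exact h1 _ _
  · exact h1 _ _
  · exact h1 _ _
  · exact h1 _ _
  · exact h1 _ _
  · exact h1 _ _

theorem mul_skew_mul_transpose_transpose (W : Matrix Color Color ℂ) (a b : Fin 3 → ℂ) :
    (W * skew a b * W.transpose).transpose = -(W * skew a b * W.transpose) := by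
  rw [Matrix.transpose_mul, Matrix.transpose_mul, Matrix.transpose_transpose, skew_transpose,
    neg_mul, mul_neg, mul_assoc]

/-- The action of a matrix on skew symmetric matrices is compatible with duality up to the
determinant. -/
theorem exists_mul_skew_mul_transpose (W : Matrix Color Color ℂ) (a b : Fin 3 → ℂ) :
    ∃ c d, W * skew a b * W.transpose = skew c d ∧
      W.transpose * skew d c * W = W.det • skew b a := by
  -- Exchanging the arguments of `skew` is the Hodge star on Λ²ℂ⁴, so the claim is Wᵀ ⋆(W A Wᵀ) W =
  -- det W · ⋆A. It is verified on the six independent entries.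
  refine ⟨_, _, eq_skew_of_transpose (mul_skew_mul_transpose_transpose W a b), ?_⟩
  simp only [mul_skew_mul_transpose_apply]
  have hd := det_color W
  rw [det_fin_four] at hd
  simp only [Matrix.submatrix_apply, Matrix.cons_val] at hd
  have hsmul : ∀ r : ℂ, r • skew b a = skew (r • b) (r • a) := fun r => by
    ext i j
    rcases i with i | i <;> rcases j with j | j <;> fin_cases i <;> fin_cases j <;>
      simp [skew, crossMatrix]
  have h := fun d c => eq_skew_of_transpose (mul_skew_mul_transpose_transpose W.transpose d c)
  have h' := mul_skew_mul_transpose_apply W.transpose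
  simp only [Matrix.transpose_transpose, Matrix.transpose_apply] at h h'
  rw [h, hd, hsmul]
  simp only [h']
  congr 1
  · ext i
    fin_cases i <;> simp only [Matrix.cons_val, Pi.smul_apply, smul_eq_mul, Fin.mk_one,
      Fin.zero_eta, Fin.reduceFinMk] <;> ring
  · ext i
    fin_cases i <;> simp only [Matrix.cons_val, Pi.smul_apply, smul_eq_mul, Fin.mk_one,
      Fin.zero_eta, Fin.reduceFinMk] <;> ring

theorem skew_injective {a b c d : Fin 3 → ℂ} (h : skew a b = skew c d) : a = c ∧ b = d := by
  constructor
  · ext i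
    fin_cases i
    · simpa [skew, crossMatrix] using congrFun (congrFun h (.inl 1)) (.inl 2)
    · simpa [skew, crossMatrix] using congrFun (congrFun h (.inl 2)) (.inl 0)
    · simpa [skew, crossMatrix] using congrFun (congrFun h (.inl 0)) (.inl 1)
  · ext i
    simpa [skew] using congrFun (congrFun h (.inl i)) (.inr ())

theorem skew_map_conj (a b : Fin 3 → ℂ) :
    (skew a b).map (starRingEnd ℂ) = skew (star a) (star b) := by
  ext i j
  rcases i with i | i <;> rcases j with j | j <;> fin_cases i <;> fin_cases j <;>
    simp [skew, crossMatrix]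

theorem colorBlock_map_conj (z : Fin 3 → ℂ) :
    (colorBlock z).map (starRingEnd ℂ) = skew z (star z) := by
  rw [colorBlock, skew_map_conj, star_star]

theorem colorBlock_conjTranspose (z : Fin 3 → ℂ) :
    (colorBlock z).conjTranspose = -skew z (star z) := by
  rw [Matrix.conjTranspose, colorBlock, skew_transpose, ← colorBlock_map_conj]
  ext i j
  simp [colorBlock]

theorem map_conj_map_conj {I J : Type*} (g : Matrix I J ℂ) :
    (g.map (starRingEnd ℂ)).map (starRingEnd ℂ) = g := by
  ext i j
  simp

theorem map_conj_mem_unitary {I : Type*} [Fintype I] [DecidableEq I] {g : Matrix I I ℂ}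
    (hg : g ∈ Matrix.unitaryGroup I ℂ) : g.map (starRingEnd ℂ) ∈ Matrix.unitaryGroup I ℂ := by
  rw [Matrix.mem_unitaryGroup_iff, ← map_conj_mul_transpose hg]
  congr 1
  ext i j
  simp [Matrix.star_apply]

/-- Vector blocks are the skew matrices A with Ā = ⋆A. For unitary W of determinant 1 the duality
identity turns into ⋆(W A Wᵀ) = W̄ ⋆A W̄ᵀ, which is the conjugate of W A Wᵀ, so this real form is
preserved. -/
theorem exists_colorBlock_eq {W : Matrix Color Color ℂ} (hW : W ∈ Matrix.unitaryGroup Color ℂ)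
    (hd : W.det = 1) (z : Fin 3 → ℂ) : ∃ y, W * colorBlock z * W.transpose = colorBlock y := by
  obtain ⟨c, d, h1, h2⟩ := exists_mul_skew_mul_transpose W (star z) z
  refine ⟨d, h1.trans ?_⟩
  rw [hd, one_smul] at h2
  have h3 : skew d c = skew (star c) (star d) := by
    calc skew d c = (W.map (starRingEnd ℂ) * W.transpose) * skew d c *
          (W * (W.map (starRingEnd ℂ)).transpose) := by
            have := map_conj_mul_transpose (map_conj_mem_unitary hW)
            rw [map_conj_map_conj] at this
            rw [this, map_conj_mul_transpose hW, one_mul, mul_one]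
      _ = W.map (starRingEnd ℂ) * (W.transpose * skew d c * W) *
          (W.map (starRingEnd ℂ)).transpose := by simp only [mul_assoc]
      _ = (W * skew (star z) z * W.transpose).map (starRingEnd ℂ) := by
            rw [h2, Matrix.map_mul, Matrix.map_mul, skew_map_conj, star_star, Matrix.transpose_map]
      _ = skew (star c) (star d) := by rw [h1, skew_map_conj]
  rw [colorBlock, (skew_injective h3).1, star_star]

/-- The same duality with the determinant kept: if one nonzero vector block stays in the real form,
then ⋆A = det W · ⋆A. -/
theorem det_eq_one_of_colorBlock {W : Matrix Color Color ℂ}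
    (hW : W ∈ Matrix.unitaryGroup Color ℂ) {z y : Fin 3 → ℂ} (hz : z ≠ 0)
    (h : W * colorBlock z * W.transpose = colorBlock y) : W.det = 1 := by
  obtain ⟨c, d, h1, h2⟩ := exists_mul_skew_mul_transpose W (star z) z
  obtain ⟨rfl, rfl⟩ := skew_injective (h1.symm.trans h)
  have h3 : skew z (star z) = W.det • skew z (star z) := by
    rw [← h2, ← colorBlock_map_conj d, ← h, Matrix.map_mul, Matrix.map_mul, colorBlock_map_conj,
      Matrix.transpose_map]
    have h4 := transpose_mul_map_conj hW
    have h5 := transpose_mul_map_conj (map_conj_mem_unitary hW)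
    rw [map_conj_map_conj] at h5
    calc skew z (star z) = 1 * skew z (star z) * 1 := by rw [one_mul, mul_one]
      _ = _ := by
        nth_rw 1 [← h4]
        rw [← h5]
        simp only [mul_assoc]
  obtain ⟨i, hi⟩ := Function.ne_iff.mp hz
  have h4 := congrFun (congrFun h3 (.inl i)) (.inr ())
  have h5 : (starRingEnd ℂ) (z i) = W.det * (starRingEnd ℂ) (z i) := by simpa [skew] using h4
  have hi' : (starRingEnd ℂ) (z i) ≠ 0 := by simpa using hi
  exact mul_right_cancel₀ hi' (by rw [← h5, one_mul])

/-! ### Block matrices and the images of Spin(4) and Spin(6) -/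

section Blocks

variable {I : Type*} [Fintype I] [DecidableEq I]

/-- The parity operator on a direct sum of two copies of `ℂ^I`. -/
def parity (I : Type*) [DecidableEq I] : Matrix (I ⊕ I) (I ⊕ I) ℂ := Matrix.fromBlocks 1 0 0 (-1)

theorem isUnit_parity : IsUnit (parity I) := by
  refine IsUnit.of_mul_eq_one (parity I) ?_
  simp [parity, Matrix.fromBlocks_multiply]

theorem parity_mul_offDiag (B C : Matrix I I ℂ) :
    parity I * Matrix.fromBlocks 0 B C 0 = -(Matrix.fromBlocks 0 B C 0 * parity I) := by
  simp [parity, Matrix.fromBlocks_multiply, Matrix.fromBlocks_neg]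

theorem parity_mul_diag (g h : Matrix I I ℂ) :
    parity I * Matrix.fromBlocks g 0 0 h = Matrix.fromBlocks g 0 0 h * parity I := by
  simp [parity, Matrix.fromBlocks_multiply]

theorem exists_eq_diag_of_parity {M : Matrix (I ⊕ I) (I ⊕ I) ℂ} (h : parity I * M = M * parity I) :
    ∃ g k, M = Matrix.fromBlocks g 0 0 k := by
  refine ⟨M.toBlocks₁₁, M.toBlocks₂₂, ?_⟩
  rw [← Matrix.fromBlocks_toBlocks M, parity, Matrix.fromBlocks_multiply,
    Matrix.fromBlocks_multiply] at h
  simp only [Matrix.fromBlocks_inj, one_mul, zero_mul, mul_one, mul_zero, add_zero, zero_add,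
    neg_mul, mul_neg] at h
  nth_rw 1 [← Matrix.fromBlocks_toBlocks M]
  have h12 : M.toBlocks₁₂ = 0 :=
    Matrix.ext fun i j => self_eq_neg.mp (congrFun (congrFun h.2.1 i) j)
  have h21 : M.toBlocks₂₁ = 0 :=
    Matrix.ext fun i j => neg_eq_self.mp (congrFun (congrFun h.2.2.1 i) j)
  rw [h12, h21]

theorem diag_mem_unitary_iff {g h : Matrix I I ℂ} :
    Matrix.fromBlocks g 0 0 h ∈ Matrix.unitaryGroup (I ⊕ I) ℂ ↔
      g ∈ Matrix.unitaryGroup I ℂ ∧ h ∈ Matrix.unitaryGroup I ℂ := by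
  simp only [Matrix.mem_unitaryGroup_iff, Matrix.star_eq_conjTranspose,
    Matrix.fromBlocks_conjTranspose, Matrix.fromBlocks_multiply, ← Matrix.fromBlocks_one,
    Matrix.fromBlocks_inj]
  simp

/-- For unitary g and h the condition on the upper right block is the adjoint of the one on the
lower left, so one equation suffices. -/
theorem diag_mul_offDiag_comm {g h B C : Matrix I I ℂ} (hg : g ∈ Matrix.unitaryGroup I ℂ)
    (hh : h ∈ Matrix.unitaryGroup I ℂ) :
    Matrix.fromBlocks g 0 0 h * Matrix.fromBlocks 0 (-B.conjTranspose) B 0 =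
      Matrix.fromBlocks 0 (-C.conjTranspose) C 0 * Matrix.fromBlocks g 0 0 h ↔
      h * B * g.conjTranspose = C := by
  have hg1 : g.conjTranspose * g = 1 := Matrix.mem_unitaryGroup_iff'.mp hg
  have hg2 : g * g.conjTranspose = 1 := Matrix.mem_unitaryGroup_iff.mp hg
  have hh1 : h.conjTranspose * h = 1 := Matrix.mem_unitaryGroup_iff'.mp hh
  rw [Matrix.fromBlocks_multiply, Matrix.fromBlocks_multiply, Matrix.fromBlocks_inj]
  simp only [mul_zero, zero_mul, add_zero, zero_add, true_and, and_true, mul_neg, neg_mul, neg_inj, neg_zero]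
  constructor
  · rintro ⟨-, h2⟩
    rw [h2, mul_assoc, hg2, mul_one]
  · rintro rfl
    simp only [Matrix.conjTranspose_mul, Matrix.conjTranspose_conjTranspose]
    constructor
    · rw [← mul_assoc g, mul_assoc _ _ h, hh1, mul_one]
    · rw [mul_assoc, hg1, mul_one]

end Blocks

theorem conjTranspose_eq_map_transpose {I J : Type*} (g : Matrix I J ℂ) :
    g.conjTranspose = (g.map (starRingEnd ℂ)).transpose := by
  ext i j
  simp

theorem isUnit_symp : IsUnit (Matrix.fromBlocks symp 0 0 symp) := by
  refine IsUnit.of_mul_eq_one (-Matrix.fromBlocks symp 0 0 symp) ?_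
  ext i j
  rcases i with i | i <;> rcases j with j | j <;> fin_cases i <;> fin_cases j <;>
    simp [symp, Matrix.mul_apply, Fin.sum_univ_two]

theorem symp_conj_offDiag (e : Fin (2 * 2) ≃ Fin 2 ⊕ Fin 2) (v) :
    Matrix.fromBlocks symp 0 0 symp *
      (cliffMatrix isospinBasis e (ι _ v)).map (starRingEnd ℂ) =
      cliffMatrix isospinBasis e (ι _ v) * Matrix.fromBlocks symp 0 0 symp := by
  rw [cliffMatrix_isospin_ι, Matrix.fromBlocks_map, Matrix.fromBlocks_multiply,
    Matrix.fromBlocks_multiply]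
  simp only [mul_zero, zero_mul, add_zero, zero_add, symp_mul_isospinBlock]
  congr 1
  · simp
  · ext i j
    fin_cases i <;> fin_cases j <;>
      simp [isospinBlock, symp, Matrix.mul_apply, Fin.sum_univ_two]
  · simp

theorem parity_isospin (e : Fin (2 * 2) ≃ Fin 2 ⊕ Fin 2) (v) :
    parity (Fin 2) * cliffMatrix isospinBasis e (ι _ v) =
      -(cliffMatrix isospinBasis e (ι _ v) * parity (Fin 2)) := by
  rw [cliffMatrix_isospin_ι, parity_mul_offDiag]

theorem parity_color (e : Fin (2 * 3) ≃ Fin 3 ⊕ Fin 3) (v) :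
    parity Color * cliffMatrix colorBasis e (ι _ v) =
      -(cliffMatrix colorBasis e (ι _ v) * parity Color) := by
  rw [cliffMatrix_color_ι, parity_mul_offDiag]

theorem symp_conj_diag_iff (g h : Matrix (Fin 2) (Fin 2) ℂ) :
    Matrix.fromBlocks symp 0 0 symp * (Matrix.fromBlocks g 0 0 h).map (starRingEnd ℂ) =
      Matrix.fromBlocks g 0 0 h * Matrix.fromBlocks symp 0 0 symp ↔
      symp * g.map (starRingEnd ℂ) = g * symp ∧ symp * h.map (starRingEnd ℂ) = h * symp := by
  rw [Matrix.fromBlocks_map, Matrix.fromBlocks_multiply, Matrix.fromBlocks_multiply,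
    Matrix.fromBlocks_inj]
  simp

/-- The elements of `Spin(4)` act on `Λ ℂ²` through `SU(2) × SU(2)`. -/
theorem exists_isospin_eq_of_spin (e : Fin (2 * 2) ≃ Fin 2 ⊕ Fin 2) (x : Spin (2 * 2)) :
    ∃ g ∈ Matrix.specialUnitaryGroup (Fin 2) ℂ, ∃ h ∈ Matrix.specialUnitaryGroup (Fin 2) ℂ,
      cliffMatrix isospinBasis e x = Matrix.fromBlocks g 0 0 h := by
  -- Even elements commute with parity, hence are block diagonal. The real structure then turns
  -- unitarity of each block into membership in SU(2).
  have h1 := cliffMatrix_involute isospinBasis e (parity_isospin e) x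
  rw [spinGroup.involute_eq x.2] at h1
  obtain ⟨g, h, hgh⟩ := exists_eq_diag_of_parity h1
  have h2 := cliffMatrix_spin_mem_unitary isospinBasis e x
  have h3 := cliffMatrix_conj isospinBasis e (symp_conj_offDiag e) x
  rw [hgh, diag_mem_unitary_iff] at h2
  rw [hgh, symp_conj_diag_iff, symp_mul_conj_iff h2.1, symp_mul_conj_iff h2.2] at h3
  exact ⟨g, ⟨h2.1, h3.1⟩, h, ⟨h2.2, h3.2⟩, hgh⟩

/-- Every element of `SU(2) × SU(2)` acts on `Λ ℂ²` as an element of `Spin(4)`. -/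
theorem exists_spin_isospin_eq (e : Fin (2 * 2) ≃ Fin 2 ⊕ Fin 2)
    {g h : Matrix (Fin 2) (Fin 2) ℂ} (hg : g ∈ Matrix.specialUnitaryGroup (Fin 2) ℂ)
    (hh : h ∈ Matrix.specialUnitaryGroup (Fin 2) ℂ) :
    ∃ x : Spin (2 * 2), cliffMatrix isospinBasis e x = Matrix.fromBlocks g 0 0 h := by
  obtain ⟨hg1, hg2⟩ := Matrix.mem_specialUnitaryGroup_iff.mp hg
  obtain ⟨hh1, hh2⟩ := Matrix.mem_specialUnitaryGroup_iff.mp hh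
  have hg3 := (symp_mul_conj_iff hg1).mpr hg2
  have hh3 := (symp_mul_conj_iff hh1).mpr hh2
  refine exists_spin_cliffMatrix_eq two_ne_zero isospinBasis e isUnit_symp isUnit_parity
    (symp_conj_offDiag e) (parity_isospin e) ((symp_conj_diag_iff g h).mpr ⟨hg3, hh3⟩)
    (parity_mul_diag g h) (diag_mem_unitary_iff.mpr ⟨hg1, hh1⟩) fun v => ?_
  -- The transformed block again commutes with the quaternionic structure, since h, B and g* all do;
  -- by `exists_isospinBlock_eq` it comes from a vector.
  have h4 : symp * (h * isospinBlock (diracCoord e v) * g.conjTranspose).map (starRingEnd ℂ) =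
      (h * isospinBlock (diracCoord e v) * g.conjTranspose) * symp := by
    have h5 : symp * (g.conjTranspose).map (starRingEnd ℂ) = g.conjTranspose * symp := by
      have hu := transpose_mul_map_conj hg1
      have hu' : g.conjTranspose * g = 1 := Matrix.mem_unitaryGroup_iff'.mp hg1
      have e1 : (g.conjTranspose).map (starRingEnd ℂ) = g.transpose := by
        ext i j
        simp
      rw [e1]
      calc symp * g.transpose = g.conjTranspose * (g * symp) * g.transpose := by
            rw [← mul_assoc, hu', one_mul]
        _ = g.conjTranspose * symp := by
            rw [← hg3, mul_assoc, mul_assoc symp, map_conj_mul_transpose hg1, mul_one]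
    rw [Matrix.map_mul, Matrix.map_mul, ← mul_assoc, ← mul_assoc, hh3, mul_assoc h,
      symp_mul_isospinBlock, ← mul_assoc, mul_assoc _ symp, h5, ← mul_assoc]
  obtain ⟨z, hz⟩ := exists_isospinBlock_eq h4
  obtain ⟨w, rfl⟩ := diracCoord_surjective e z
  exact ⟨w, by rw [cliffMatrix_isospin_ι, cliffMatrix_isospin_ι, diag_mul_offDiag_comm hg1 hh1, hz]⟩

/-- The exchange of the two summands. -/
def swapBlocks (I : Type*) [DecidableEq I] : Matrix (I ⊕ I) (I ⊕ I) ℂ := Matrix.fromBlocks 0 1 1 0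

theorem isUnit_swapBlocks : IsUnit (swapBlocks Color) := by
  refine IsUnit.of_mul_eq_one (swapBlocks Color) ?_
  simp [swapBlocks, Matrix.fromBlocks_multiply]

theorem swapBlocks_conj_offDiag (e : Fin (2 * 3) ≃ Fin 3 ⊕ Fin 3) (v) :
    swapBlocks Color * (cliffMatrix colorBasis e (ι _ v)).map (starRingEnd ℂ) =
      cliffMatrix colorBasis e (ι _ v) * swapBlocks Color := by
  rw [cliffMatrix_color_ι, Matrix.fromBlocks_map, swapBlocks, Matrix.fromBlocks_multiply,
    Matrix.fromBlocks_multiply, colorBlock_conjTranspose, colorBlock_map_conj, neg_neg,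
    skew_map_conj, star_star, colorBlock]
  simp

theorem swapBlocks_conj_diag_iff (g h : Matrix Color Color ℂ) :
    swapBlocks Color * (Matrix.fromBlocks g 0 0 h).map (starRingEnd ℂ) =
      Matrix.fromBlocks g 0 0 h * swapBlocks Color ↔ h = g.map (starRingEnd ℂ) := by
  rw [Matrix.fromBlocks_map, swapBlocks, Matrix.fromBlocks_multiply, Matrix.fromBlocks_multiply,
    Matrix.fromBlocks_inj]
  simp only [zero_mul, one_mul, mul_zero, mul_one, add_zero, zero_add, Matrix.map_zero _ (map_zero _)]
  constructor
  · rintro ⟨-, -, h1, -⟩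
    exact h1.symm
  · rintro rfl
    exact ⟨trivial, map_conj_map_conj g, rfl, trivial⟩

theorem map_conj_det {I : Type*} [Fintype I] [DecidableEq I] (g : Matrix I I ℂ) :
    (g.map (starRingEnd ℂ)).det = (starRingEnd ℂ) g.det :=
  ((starRingEnd ℂ).map_det g).symm

/-- The elements of `Spin(6)` act on `Λ ℂ³` through `SU(4)`. -/
theorem exists_color_eq_of_spin (e : Fin (2 * 3) ≃ Fin 3 ⊕ Fin 3) (x : Spin (2 * 3)) :
    ∃ g ∈ Matrix.specialUnitaryGroup Color ℂ,
      cliffMatrix colorBasis e x = Matrix.fromBlocks g 0 0 (g.map (starRingEnd ℂ)) := by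
  have h1 := cliffMatrix_involute colorBasis e (parity_color e) x
  rw [spinGroup.involute_eq x.2] at h1
  obtain ⟨g, h, hgh⟩ := exists_eq_diag_of_parity h1
  have h2 := cliffMatrix_spin_mem_unitary colorBasis e x
  have h3 := cliffMatrix_conj colorBasis e (swapBlocks_conj_offDiag e) x
  rw [hgh, swapBlocks_conj_diag_iff] at h3
  subst h3
  rw [hgh, diag_mem_unitary_iff] at h2
  refine ⟨g, ⟨h2.1, ?_⟩, hgh⟩
  -- Parity, unitarity and the real structure only give g in U(4). The determinant is pinned down by
  -- conjugating a nonzero vector; the one with all coordinates 1 serves.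
  obtain ⟨v, hv⟩ := diracCoord_surjective e 1
  obtain ⟨w, hw⟩ := cliffMatrix_spin_conj colorBasis e x v
  rw [hgh, cliffMatrix_color_ι, cliffMatrix_color_ι, diag_mul_offDiag_comm h2.1 h2.2, hv,
    conjTranspose_eq_map_transpose] at hw
  have h4 := det_eq_one_of_colorBlock h2.2 one_ne_zero hw
  rw [map_conj_det] at h4
  have h5 := congrArg (starRingEnd ℂ) h4
  rwa [Complex.conj_conj, map_one] at h5

/-- Every element of `SU(4)` acts on `Λ ℂ³` as an element of `Spin(6)`. -/
theorem exists_spin_color_eq (e : Fin (2 * 3) ≃ Fin 3 ⊕ Fin 3) {g : Matrix Color Color ℂ}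
    (hg : g ∈ Matrix.specialUnitaryGroup Color ℂ) :
    ∃ x : Spin (2 * 3),
      cliffMatrix colorBasis e x = Matrix.fromBlocks g 0 0 (g.map (starRingEnd ℂ)) := by
  obtain ⟨hg1, hg2⟩ := Matrix.mem_specialUnitaryGroup_iff.mp hg
  have hh1 := map_conj_mem_unitary hg1
  refine exists_spin_cliffMatrix_eq three_ne_zero colorBasis e isUnit_swapBlocks isUnit_parity
    (swapBlocks_conj_offDiag e) (parity_color e) ((swapBlocks_conj_diag_iff _ _).mpr rfl)
    (parity_mul_diag _ _) (diag_mem_unitary_iff.mpr ⟨hg1, hh1⟩) fun v => ?_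
  -- With h = ḡ one has g* = hᵀ, so conjugating a vector acts on its block B by h B hᵀ.
  obtain ⟨z, hz⟩ := exists_colorBlock_eq hh1 (by rw [map_conj_det, hg2, map_one]) (diracCoord e v)
  obtain ⟨w, rfl⟩ := diracCoord_surjective e z
  exact ⟨w, by rw [cliffMatrix_color_ι, cliffMatrix_color_ι, diag_mul_offDiag_comm hg1 hh1,
    conjTranspose_eq_map_transpose, hz]⟩

/-! ### The isomorphism α and its uniqueness -/

open Topology

/-- Both groups are homeomorphic to the common image; since the maps into M are multiplicative and
injective, so is the resulting homeomorphism. -/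
theorem exists_continuousMulEquiv {G H M : Type*} [Group G] [Group H] [Monoid M]
    [TopologicalSpace G] [TopologicalSpace H] [TopologicalSpace M] (f : G →* M) (g : H →* M)
    (hf : IsEmbedding f) (hg : IsEmbedding g) (h : Set.range f = Set.range g) :
    ∃ φ : G ≃ₜ* H, ∀ x, g (φ x) = f x := by
  let φ : G ≃ₜ H := hf.toHomeomorph.trans ((Homeomorph.setCongr h).trans hg.toHomeomorph.symm)
  have hφ : ∀ x, g (φ x) = f x := fun x =>
    congrArg Subtype.val (hg.toHomeomorph.apply_symm_apply (Homeomorph.setCongr h (hf.toHomeomorph x)))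
  refine ⟨{ φ with
    map_mul' := fun x y => hg.injective ?_ }, hφ⟩
  exact (hφ _).trans (by rw [map_mul, map_mul]; exact congrArg₂ _ (hφ x).symm (hφ y).symm)

instance cliffModuleTopology (m : ℕ) : IsModuleTopology ℝ (Cliff m) := ⟨rfl⟩

/-- An injective linear map of finite-dimensional spaces has a linear left inverse, and for the
canonical topology both maps are continuous. -/
theorem isEmbedding_cliffMatrix {n : ℕ} {I : Type*} [Fintype I] [DecidableEq I]
    (b : OrthonormalBasis I ℂ (ExtAlg n)) (e : Fin (2 * n) ≃ Fin n ⊕ Fin n) :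
    IsEmbedding (cliffMatrix b e) := by
  have : IsTopologicalAddGroup (Cliff (2 * n)) := IsModuleTopology.topologicalAddGroup ℝ _
  have : ContinuousSMul ℝ (Cliff (2 * n)) := IsModuleTopology.toContinuousSMul ℝ _
  obtain ⟨L, hL⟩ := (cliffMatrix b e).toLinearMap.exists_leftInverse_of_injective
    (LinearMap.ker_eq_bot.mpr (cliffMatrix_injective b e))
  refine Function.LeftInverse.isEmbedding (f := L) (fun x => LinearMap.congr_fun hL x) ?_ ?_
  · exact L.continuous_of_finiteDimensional
  · exact IsModuleTopology.continuous_of_linearMap (R := ℝ) (cliffMatrix b e).toLinearMap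

/-- The action of the spin group on spinors, as matrices in an orthonormal basis. -/
noncomputable def spinMatrix {n : ℕ} {I : Type*} [Fintype I] [DecidableEq I]
    (b : OrthonormalBasis I ℂ (ExtAlg n)) (e : Fin (2 * n) ≃ Fin n ⊕ Fin n) :
    Spin (2 * n) →* Matrix I I ℂ :=
  ((cliffMatrix b e : Cliff (2 * n) →ₐ[ℝ] Matrix I I ℂ) : Cliff (2 * n) →* Matrix I I ℂ).comp
    (spinGroup (cliffForm (2 * n))).subtype

theorem spinMatrix_apply {n : ℕ} {I : Type*} [Fintype I] [DecidableEq I]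
    (b : OrthonormalBasis I ℂ (ExtAlg n)) (e : Fin (2 * n) ≃ Fin n ⊕ Fin n) (x : Spin (2 * n)) :
    spinMatrix b e x = cliffMatrix b e x := rfl

theorem isEmbedding_spinMatrix {n : ℕ} {I : Type*} [Fintype I] [DecidableEq I]
    (b : OrthonormalBasis I ℂ (ExtAlg n)) (e : Fin (2 * n) ≃ Fin n ⊕ Fin n) :
    IsEmbedding (spinMatrix b e) :=
  (isEmbedding_cliffMatrix b e).comp IsEmbedding.subtypeVal

/-- The matrices of `isospinRep`. -/
def isospinHom : PSGroup →* Matrix (Fin 2 ⊕ Fin 2) (Fin 2 ⊕ Fin 2) ℂ where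
  toFun := fun x => Matrix.fromBlocks x.1.1 0 0 x.2.1.1
  map_one' := by simp
  map_mul' := fun x y => by simp [Matrix.fromBlocks_multiply]

theorem isospinRep_eq : isospinRep = matrixRep isospinHom := rfl

/-- The matrices of `colorRep`. -/
def colorHom : PSGroup →* Matrix (Color ⊕ Color) (Color ⊕ Color) ℂ := withDual
  { toFun := fun x => x.2.2.1
    map_one' := rfl
    map_mul' := fun _ _ => rfl }

theorem colorRep_eq : colorRep = matrixRep colorHom := rfl

theorem isospinHom_apply (x : PSGroup) :
    isospinHom x = Matrix.fromBlocks x.1.1 0 0 x.2.1.1 := rfl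

theorem colorHom_apply (x : PSGroup) :
    colorHom x = Matrix.fromBlocks x.2.2.1 0 0 (x.2.2.1.map (starRingEnd ℂ)) := by
  have h : x.2.2⁻¹.1.transpose = x.2.2.1.map (starRingEnd ℂ) := by
    ext i j
    rfl
  rw [← h]
  rfl

theorem isEmbedding_psMatrix : IsEmbedding (isospinHom.prod colorHom) := by
  let f : Matrix (Fin 2) (Fin 2) ℂ × Matrix (Fin 2) (Fin 2) ℂ × Matrix Color Color ℂ →
      Matrix (Fin 2 ⊕ Fin 2) (Fin 2 ⊕ Fin 2) ℂ × Matrix (Color ⊕ Color) (Color ⊕ Color) ℂ :=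
    fun x => (Matrix.fromBlocks x.1 0 0 x.2.1,
      Matrix.fromBlocks x.2.2 0 0 (x.2.2.map (starRingEnd ℂ)))
  let g : Matrix (Fin 2 ⊕ Fin 2) (Fin 2 ⊕ Fin 2) ℂ × Matrix (Color ⊕ Color) (Color ⊕ Color) ℂ →
      Matrix (Fin 2) (Fin 2) ℂ × Matrix (Fin 2) (Fin 2) ℂ × Matrix Color Color ℂ :=
    fun y => (y.1.toBlocks₁₁, y.1.toBlocks₂₂, y.2.toBlocks₁₁)
  have hgf : Function.LeftInverse g f := fun x => by simp [f, g]
  have hf : Continuous f := by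
    refine Continuous.prodMk ?_ ?_
    · exact Continuous.matrix_fromBlocks continuous_fst continuous_const continuous_const
        (continuous_fst.comp continuous_snd)
    · exact Continuous.matrix_fromBlocks (continuous_snd.comp continuous_snd) continuous_const
        continuous_const ((continuous_snd.comp continuous_snd).matrix_map Complex.continuous_conj)
  have hg : Continuous g := by
    refine Continuous.prodMk ?_ (Continuous.prodMk ?_ ?_)
    · exact continuous_fst.matrix_submatrix _ _
    · exact continuous_fst.matrix_submatrix _ _
    · exact continuous_snd.matrix_submatrix _ _
  have h := (hgf.isEmbedding hg hf).comp ((IsEmbedding.subtypeVal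
    (p := fun g => g ∈ Matrix.specialUnitaryGroup (Fin 2) ℂ)).prodMap ((IsEmbedding.subtypeVal
    (p := fun g => g ∈ Matrix.specialUnitaryGroup (Fin 2) ℂ)).prodMap (IsEmbedding.subtypeVal
    (p := fun g => g ∈ Matrix.specialUnitaryGroup Color ℂ))))
  convert h using 1
  funext x
  exact Prod.ext rfl (colorHom_apply x)

theorem range_psMatrix (e₂ : Fin (2 * 2) ≃ Fin 2 ⊕ Fin 2) (e₃ : Fin (2 * 3) ≃ Fin 3 ⊕ Fin 3) :
    Set.range (isospinHom.prod colorHom) =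
      Set.range ((spinMatrix isospinBasis e₂).prodMap (spinMatrix colorBasis e₃)) := by
  apply Set.Subset.antisymm
  · rintro _ ⟨⟨g, h, u⟩, rfl⟩
    obtain ⟨x, hx⟩ := exists_spin_isospin_eq e₂ g.2 h.2
    obtain ⟨y, hy⟩ := exists_spin_color_eq e₃ u.2
    exact ⟨(x, y), Prod.ext hx (hy.trans (colorHom_apply (g, h, u)).symm)⟩
  · rintro _ ⟨⟨x, y⟩, rfl⟩
    obtain ⟨g, hg, h, hh, hx⟩ := exists_isospin_eq_of_spin e₂ x
    obtain ⟨u, hu, hy⟩ := exists_color_eq_of_spin e₃ y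
    exact ⟨(⟨g, hg⟩, ⟨h, hh⟩, ⟨u, hu⟩), Prod.ext hx.symm ((colorHom_apply _).trans hy.symm)⟩

theorem exists_spinIso (e₂ : Fin (2 * 2) ≃ Fin 2 ⊕ Fin 2) (e₃ : Fin (2 * 3) ≃ Fin 3 ⊕ Fin 3) :
    ∃ α : PSGroup ≃ₜ* Spin (2 * 2) × Spin (2 * 3), ∀ x,
      spinMatrix isospinBasis e₂ (α x).1 = isospinHom x ∧
      spinMatrix colorBasis e₃ (α x).2 = colorHom x := by
  obtain ⟨α, hα⟩ := exists_continuousMulEquiv (isospinHom.prod colorHom)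
    ((spinMatrix isospinBasis e₂).prodMap (spinMatrix colorBasis e₃)) isEmbedding_psMatrix
    ((isEmbedding_spinMatrix isospinBasis e₂).prodMap (isEmbedding_spinMatrix colorBasis e₃))
    (range_psMatrix e₂ e₃)
  exact ⟨α, fun x => ⟨congrArg Prod.fst (hα x), congrArg Prod.snd (hα x)⟩⟩

theorem matrixRep_single {G I : Type*} [Group G] [Fintype I] [DecidableEq I]
    (ρ : G →* Matrix I I ℂ) (x : G) (j : I) :
    matrixRep ρ x (EuclideanSpace.single j 1) = ∑ i, ρ x i j • EuclideanSpace.single i (1 : ℂ) := by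
  ext i
  simp [matrixRep, Matrix.toLpLinAlgEquiv, Matrix.toLpLin, Pi.single_apply]

/-- A unitary operator intertwines a matrix representation with the Dirac spinor representation
exactly when the latter is given by the same matrices. -/
theorem conj_matrixRep_eq_dirac_iff {G I : Type*} [Group G] [Fintype I] [DecidableEq I] {n : ℕ}
    (k : EuclideanSpace ℂ I ≃ₗᵢ[ℂ] ExtAlg n) (ρ : G →* Matrix I I ℂ) (x : G)
    (e : Fin (2 * n) ≃ Fin n ⊕ Fin n) (y : Spin (2 * n)) :
    k.toLinearEquiv.conj (matrixRep ρ x) = dirac e y ↔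
      spinMatrix ((EuclideanSpace.basisFun I ℂ).map k) e y = ρ x := by
  have hb : ∀ i, ((EuclideanSpace.basisFun I ℂ).map k) i = k (EuclideanSpace.single i 1) :=
    fun i => by simp
  have hk : ∀ j, k.toLinearEquiv.conj (matrixRep ρ x) (((EuclideanSpace.basisFun I ℂ).map k) j) =
      ∑ i, ρ x i j • ((EuclideanSpace.basisFun I ℂ).map k) i := fun j => by
    simp only [hb]
    rw [LinearEquiv.conj_apply_apply]
    have : k.toLinearEquiv.symm (k (EuclideanSpace.single j 1)) = EuclideanSpace.single j 1 :=
      k.symm_apply_apply _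
    rw [this, matrixRep_single, map_sum]
    exact Finset.sum_congr rfl fun i _ => map_smul k _ _
  constructor
  · intro h
    refine cliffMatrix_eq_of_basis _ e fun j => ?_
    rw [← hk, h]
    rfl
  · intro h
    refine ((EuclideanSpace.basisFun I ℂ).map k).toBasis.ext fun j => ?_
    rw [OrthonormalBasis.coe_toBasis, hk, ← h]
    exact (cliffAction_basis _ e y j).symm

/-- The definition prescribes nothing on Λ^ev ℂ³, yet all of it is determined. The maps `colorOp 1`
and `colorOp (-1)` agree on ℂ⁴, so the basis with ε = -1 may be used throughout. -/
theorem isSpinorIso_iff (e₂ : Fin (2 * 2) ≃ Fin 2 ⊕ Fin 2) (e₃ : Fin (2 * 3) ≃ Fin 3 ⊕ Fin 3)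
    (α : PSGroup ≃ₜ* Spin (2 * 2) × Spin (2 * 3)) :
    IsSpinorIso e₂ e₃ α ↔ ∀ x, spinMatrix isospinBasis e₂ (α x).1 = isospinHom x ∧
      spinMatrix colorBasis e₃ (α x).2 = colorHom x := by
  have hcol : ∀ c : Color, colorOp 1 (EuclideanSpace.single (.inl c) 1) = colorBasis (.inl c) := by
    intro c
    rw [colorBasis_apply, colorOp, unitaryOfFamily_single]
    rcases c with c | c <;> rfl
  have hrep : ∀ x (c : Color), colorOp 1 (colorRep x (EuclideanSpace.single (.inl c) 1)) =
      ∑ i, x.2.2.1 i c • colorBasis (.inl i) := by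
    intro x c
    rw [colorRep_eq, matrixRep_single, Fintype.sum_sum_type, colorHom_apply]
    simp only [Matrix.fromBlocks_apply₁₁, Matrix.fromBlocks_apply₂₁, Matrix.zero_apply, zero_smul,
      Finset.sum_const_zero, add_zero, map_sum, map_smul, hcol]
  constructor
  · intro h x
    constructor
    · refine (conj_matrixRep_eq_dirac_iff isospinOp isospinHom x e₂ (α x).1).mp ?_
      refine LinearMap.ext fun ψ => ?_
      have := h.isospin x (isospinOp.symm ψ)
      rw [isospinOp.apply_symm_apply] at this
      exact this.symm
    -- A spin element has matrix (g, ḡ), so knowing its action g on ℂ⁴ gives the dual block for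
    -- free.
    · obtain ⟨g, hg, hy⟩ := exists_color_eq_of_spin e₃ (α x).2
      have hgx : g = x.2.2.1 := by
        ext i c
        have h1 := h.color x c
        rw [hcol, hrep] at h1
        have h2 : cliffAction e₃ (α x).2 (colorBasis (.inl c)) = _ := h1
        rw [cliffAction_basis, hy, Fintype.sum_sum_type] at h2
        simp only [Matrix.fromBlocks_apply₁₁, Matrix.fromBlocks_apply₂₁, Matrix.zero_apply,
          zero_smul, Finset.sum_const_zero, add_zero] at h2
        have h3 := congrArg (fun ψ => ⟪colorBasis (.inl i), ψ⟫_ℂ) h2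
        simp only [inner_sum, inner_smul_right, orthonormal_iff_ite.mp colorBasis.orthonormal,
          Sum.inl.injEq, mul_ite, mul_one, mul_zero, Finset.sum_ite_eq, Finset.mem_univ,
          if_true] at h3
        exact h3
      rw [spinMatrix_apply, hy, colorHom_apply, hgx]
  · intro h
    constructor
    · intro x v
      have h1 := (conj_matrixRep_eq_dirac_iff isospinOp isospinHom x e₂ (α x).1).mpr (h x).1
      have h2 := LinearMap.congr_fun h1 (isospinOp v)
      rw [← h2, LinearEquiv.conj_apply_apply]
      exact congrArg (fun w => isospinOp (isospinRep x w)) (isospinOp.symm_apply_apply v)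
    · intro x c
      rw [hcol, hrep]
      have h1 := cliffAction_basis colorBasis e₃ (α x).2 (.inl c)
      rw [← spinMatrix_apply, (h x).2, colorHom_apply, Fintype.sum_sum_type] at h1
      simp only [Matrix.fromBlocks_apply₁₁, Matrix.fromBlocks_apply₂₁, Matrix.zero_apply, zero_smul,
        Finset.sum_const_zero, add_zero] at h1
      exact h1

/-- Uniqueness holds because the spin groups act faithfully and the matrices of each α(x) are
prescribed. -/
theorem existsUnique_isSpinorIso (e₂ : Fin (2 * 2) ≃ Fin 2 ⊕ Fin 2)
    (e₃ : Fin (2 * 3) ≃ Fin 3 ⊕ Fin 3) :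
    ∃! α : PSGroup ≃ₜ* Spin (2 * 2) × Spin (2 * 3), IsSpinorIso e₂ e₃ α := by
  simp only [isSpinorIso_iff]
  obtain ⟨α, hα⟩ := exists_spinIso e₂ e₃
  refine ⟨α, hα, fun γ hγ => ?_⟩
  ext x : 1
  refine Prod.ext ((isEmbedding_spinMatrix isospinBasis e₂).injective ?_)
    ((isEmbedding_spinMatrix colorBasis e₃).injective ?_)
  · rw [(hα x).1, (hγ x).1]
  · rw [(hα x).2, (hγ x).2]

/-! ### Unitarity of the three representations -/

section Unitary

variable {G I : Type*} [Group G] [Fintype I] [DecidableEq I]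

theorem matrixRep_mem_unitary {ρ : G →* Matrix I I ℂ}
    (hρ : ∀ x, ρ x⁻¹ = (ρ x).conjTranspose) (x : G) :
    matrixRep ρ x ∈ unitary (EuclideanSpace ℂ I →ₗ[ℂ] EuclideanSpace ℂ I) := by
  have h : star (matrixRep ρ x) = matrixRep ρ x⁻¹ := by
    rw [LinearMap.star_eq_adjoint]
    have h1 : matrixRep ρ x⁻¹ = Matrix.toEuclideanLin (ρ x⁻¹) := rfl
    rw [h1, hρ, Matrix.toEuclideanLin_conjTranspose_eq_adjoint]
    rfl
  rw [Unitary.mem_iff, h, ← map_mul, ← map_mul, inv_mul_cancel, mul_inv_cancel, map_one]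
  exact ⟨rfl, rfl⟩

theorem withDual_inv {ρ : G →* Matrix I I ℂ} (hρ : ∀ x, ρ x⁻¹ = (ρ x).conjTranspose) (x : G) :
    withDual ρ x⁻¹ = (withDual ρ x).conjTranspose := by
  change Matrix.fromBlocks _ _ _ _ = (Matrix.fromBlocks _ _ _ _).conjTranspose
  rw [Matrix.fromBlocks_conjTranspose, hρ, inv_inv]
  simp only [Matrix.conjTranspose_zero]
  congr 1
  ext i j
  simp

theorem withDual_apply {ρ : G →* Matrix I I ℂ} (hρ : ∀ x, ρ x⁻¹ = (ρ x).conjTranspose) (x : G) :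
    withDual ρ x = Matrix.fromBlocks (ρ x) 0 0 ((ρ x).map (starRingEnd ℂ)) := by
  change Matrix.fromBlocks _ _ _ _ = _
  rw [hρ]
  rfl

theorem isospinHom_inv (x : PSGroup) : isospinHom x⁻¹ = (isospinHom x).conjTranspose := by
  rw [isospinHom_apply, isospinHom_apply, Matrix.fromBlocks_conjTranspose]
  simp only [Matrix.conjTranspose_zero]
  rfl

theorem colorHom_inv (x : PSGroup) : colorHom x⁻¹ = (colorHom x).conjTranspose :=
  withDual_inv (fun _ => rfl) x

theorem fermionHom_inv (x : GSM) : fermionHom x⁻¹ = (fermionHom x).conjTranspose := by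
  have hα : ((x⁻¹).1 : ℂ) = (starRingEnd ℂ) (x.1 : ℂ) := Circle.coe_inv_eq_conj x.1
  have hg : ∀ i j, (x⁻¹).2.1.1 i j = (starRingEnd ℂ) (x.2.1.1 j i) := fun _ _ => rfl
  have hh : ∀ i j, (x⁻¹).2.2.1 i j = (starRingEnd ℂ) (x.2.2.1 j i) := fun _ _ => rfl
  ext a b
  change fermionMatrix x⁻¹ a b = (starRingEnd ℂ) (fermionMatrix x b a)
  cases a <;> cases b <;> simp only [fermionMatrix, hα, hg, hh, map_mul, map_zpow₀, map_zero]

theorem tensorProduct_map_mem_unitary {V W : Type*} [NormedAddCommGroup V] [InnerProductSpace ℂ V]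
    [FiniteDimensional ℂ V] [NormedAddCommGroup W] [InnerProductSpace ℂ W] [FiniteDimensional ℂ W]
    {S : V →ₗ[ℂ] V} {T : W →ₗ[ℂ] W} (hS : S ∈ unitary (V →ₗ[ℂ] V)) (hT : T ∈ unitary (W →ₗ[ℂ] W)) :
    TensorProduct.map S T ∈ unitary (V ⊗[ℂ] W →ₗ[ℂ] V ⊗[ℂ] W) := by
  rw [Unitary.mem_iff] at hS hT ⊢
  rw [LinearMap.star_eq_adjoint] at hS hT ⊢
  rw [TensorProduct.adjoint_map, ← TensorProduct.map_mul, ← TensorProduct.map_mul, hS.1, hS.2,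
    hT.1, hT.2, TensorProduct.map_one]
  exact ⟨rfl, rfl⟩

theorem dirac_mem_unitary {n : ℕ} (e : Fin (2 * n) ≃ Fin n ⊕ Fin n) (y : Spin (2 * n)) :
    dirac e y ∈ unitary (ExtAlg n →ₗ[ℂ] ExtAlg n) := by
  have h : dirac e y = cliffAction e y := rfl
  rw [h, Unitary.mem_iff, ← cliffAction_star, ← map_mul, ← map_mul,
    spinGroup.star_mul_self_of_mem y.2, spinGroup.mul_star_self_of_mem y.2, map_one]
  exact ⟨rfl, rfl⟩

end Unitary

/-! ### Intertwining by k and ℓ; the commutative square -/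

theorem kOp_conj_psRep (ε : ℤˣ) (x : PSGroup) :
    (kOp ε).toLinearEquiv.conj (psRep x) = TensorProduct.map
      (isospinOp.toLinearEquiv.conj (isospinRep x)) ((colorOp ε).toLinearEquiv.conj (colorRep x)) := by
  refine TensorProduct.ext' fun ψ φ => ?_
  rfl

theorem kOp_neg_one_conj_psRep {e₂ : Fin (2 * 2) ≃ Fin 2 ⊕ Fin 2} {e₃ : Fin (2 * 3) ≃ Fin 3 ⊕ Fin 3}
    {α : PSGroup ≃ₜ* Spin (2 * 2) × Spin (2 * 3)} (hα : IsSpinorIso e₂ e₃ α) (x : PSGroup) :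
    (kOp (-1)).toLinearEquiv.conj (psRep x) = diracTensor e₂ e₃ (α x) := by
  obtain ⟨h1, h2⟩ := (isSpinorIso_iff e₂ e₃ α).mp hα x
  rw [kOp_conj_psRep, isospinRep_eq, colorRep_eq,
    (conj_matrixRep_eq_dirac_iff isospinOp isospinHom x e₂ (α x).1).mpr h1,
    (conj_matrixRep_eq_dirac_iff (colorOp (-1)) colorHom x e₃ (α x).2).mpr h2]
  rfl

theorem psRep_psVec (x : PSGroup) (i : Fin 2 ⊕ Fin 2) (c : Color ⊕ Color) :
    psRep x (psVec i c) = ∑ j, ∑ d, (isospinHom x j i * colorHom x d c) • psVec j d := by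
  have h : psRep x (psVec i c) = isospinRep x (EuclideanSpace.single i 1) ⊗ₜ[ℂ]
    colorRep x (EuclideanSpace.single c 1) := rfl
  rw [h, isospinRep_eq, colorRep_eq, matrixRep_single, matrixRep_single, TensorProduct.sum_tmul]
  refine Finset.sum_congr rfl fun j _ => ?_
  rw [TensorProduct.tmul_sum]
  refine Finset.sum_congr rfl fun d _ => ?_
  rw [TensorProduct.smul_tmul_smul]
  rfl

/-- The isomorphism ℂ²* ≅ ℂ² in coordinates; it explains the minus signs on ν̄_R and ū_R in
`psCode`. -/
theorem specialUnitary_two_conj (g : Matrix.specialUnitaryGroup (Fin 2) ℂ) :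
    (starRingEnd ℂ) (g.1 0 0) = g.1 1 1 ∧ (starRingEnd ℂ) (g.1 0 1) = -g.1 1 0 ∧
      (starRingEnd ℂ) (g.1 1 0) = -g.1 0 1 ∧ (starRingEnd ℂ) (g.1 1 1) = g.1 0 0 := by
  obtain ⟨h1, h2⟩ := Matrix.mem_specialUnitaryGroup_iff.mp g.2
  have h := (symp_mul_conj_iff h1).mpr h2
  have h00 := congrFun (congrFun h 0) 0
  have h01 := congrFun (congrFun h 0) 1
  have h10 := congrFun (congrFun h 1) 0
  have h11 := congrFun (congrFun h 1) 1
  simp [symp, Matrix.mul_apply, Fin.sum_univ_two] at h00 h01 h10 h11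
  refine ⟨h10, ?_, h00, h01⟩
  rw [← h11, neg_neg]

theorem Fermion.sum_eq_smul {V : Type*} [AddCommGroup V] (f : Fermion → V) :
    ∑ x, f x = (∑ i, f (.leptonL i)) + (∑ i, ∑ c, f (.quarkL i c)) + f .neutrinoR +
      f .electronR + (∑ c, f (.upR c)) + ∑ c, f (.downR c) := by
  have h : (Finset.univ : Finset Fermion) =
      {.leptonL 0, .leptonL 1, .quarkL 0 0, .quarkL 0 1, .quarkL 0 2, .quarkL 1 0, .quarkL 1 1,
        .quarkL 1 2, .neutrinoR, .electronR, .upR 0, .upR 1, .upR 2, .downR 0, .downR 1,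
        .downR 2} := by decide
  rw [h]
  simp [Fin.sum_univ_succ]
  abel

theorem isospinHom_beta (x : GSM) : isospinHom (beta x) =
    Matrix.fromBlocks x.2.1.1 0 0 (Matrix.diagonal ![(x.1 : ℂ) ^ (3 : ℤ), (x.1 : ℂ) ^ (-3 : ℤ)]) :=
  rfl

theorem colorHom_beta (x : GSM) : colorHom (beta x) = Matrix.fromBlocks
    (Matrix.fromBlocks ((x.1 : ℂ) • x.2.2.1) 0 0 (Matrix.diagonal fun _ => (x.1 : ℂ) ^ (-3 : ℤ))) 0 0
    ((Matrix.fromBlocks ((x.1 : ℂ) • x.2.2.1) 0 0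
      (Matrix.diagonal fun _ => (x.1 : ℂ) ^ (-3 : ℤ))).map (starRingEnd ℂ)) :=
  colorHom_apply _

/-- Each fermion's hypercharge is the sum of an isospin part (0 for left, ±3 for right, as powers of
α) and a colour part (1 for r, g, b and -3 for w); dual vectors take the opposite powers. -/
theorem ellOp_smRep_single (x : GSM) (f : Fermion ⊕ Fermion) :
    ellOp (smRep x (EuclideanSpace.single f 1)) = psRep (beta x) (psCode f) := by
  have hl : ∀ f, ellOp (EuclideanSpace.single f 1) = psCode f := fun f =>
    unitaryOfFamily_single _ _ _ f
  have hα0 : (x.1 : ℂ) ≠ 0 := Circle.coe_ne_zero x.1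
  have hα : (starRingEnd ℂ) (x.1 : ℂ) = (x.1 : ℂ)⁻¹ := by
    rw [← Circle.coe_inv_eq_conj, Circle.coe_inv]
  -- The sums of exponents in the right-handed sector and its dual: -3 + 1 = -2 for d_R, 3 - 1 = 2
  -- for its dual, -3 - 3 = -6 for e⁻_R, and -3 - 1 = -4 for the dual of u_R.
  have h1 : ∀ t : ℂ, ((x.1 : ℂ) ^ 3)⁻¹ * ((x.1 : ℂ) * t) = ((x.1 : ℂ) ^ 2)⁻¹ * t := fun t => by
    field_simp
  have h2 : ∀ t : ℂ, (x.1 : ℂ) ^ 3 * ((x.1 : ℂ)⁻¹ * t) = (x.1 : ℂ) ^ 2 * t := fun t => by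
    field_simp
  have h3 : ((x.1 : ℂ) ^ 3)⁻¹ * ((x.1 : ℂ) ^ 3)⁻¹ = ((x.1 : ℂ) ^ 6)⁻¹ := by
    field_simp
  have h4 : ∀ t : ℂ, ((x.1 : ℂ) ^ 3)⁻¹ * ((x.1 : ℂ)⁻¹ * t) = ((x.1 : ℂ) ^ 4)⁻¹ * t := fun t => by
    field_simp
  obtain ⟨g00, g01, g10, g11⟩ := specialUnitary_two_conj x.2.1
  rw [smRep, matrixRep_single, map_sum]
  simp only [map_smul, hl]
  rw [withDual_apply fermionHom_inv, Fintype.sum_sum_type]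
  have hf : fermionHom x = fermionMatrix x := rfl
  rw [hf]
  rcases f with (i | ⟨i, c⟩ | _ | _ | c | c) | (i | ⟨i, c⟩ | _ | _ | c | c)
  all_goals try fin_cases i
  all_goals
    simp [Fermion.sum_eq_smul, psCode, psRep_psVec, isospinHom_beta, colorHom_beta, fermionMatrix,
      Fin.sum_univ_two, Fin.sum_univ_three, hα, g00, g01, g10, g11]
  all_goals try simp only [h1, h2, h3, h4]
  all_goals module

theorem ellOp_conj_smRep (x : GSM) : ellOp.toLinearEquiv.conj (smRep x) = psRep (beta x) := by
  have h : ellOp.toLinearMap ∘ₗ smRep x = psRep (beta x) ∘ₗ ellOp.toLinearMap := by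
    refine (EuclideanSpace.basisFun (Fermion ⊕ Fermion) ℂ).toBasis.ext fun f => ?_
    rw [OrthonormalBasis.coe_toBasis, EuclideanSpace.basisFun_apply]
    refine (ellOp_smRep_single x f).trans ?_
    exact congrArg (psRep (beta x)) (unitaryOfFamily_single _ _ _ f).symm
  refine LinearMap.ext fun ψ => ?_
  rw [LinearEquiv.conj_apply_apply]
  refine (LinearMap.congr_fun h (ellOp.symm ψ)).trans ?_
  exact congrArg (psRep (beta x)) (ellOp.apply_symm_apply ψ)

/-- Changing ε rescales the single vector w̄. The matrices of β(G_SM) are block diagonal for the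
splitting of w̄ from r̄, ḡ, b̄, so they commute with this rescaling; general elements of SU(4) do
not. -/
theorem colorOp_conj_colorRep_beta {e₂ : Fin (2 * 2) ≃ Fin 2 ⊕ Fin 2}
    {e₃ : Fin (2 * 3) ≃ Fin 3 ⊕ Fin 3} {α : PSGroup ≃ₜ* Spin (2 * 2) × Spin (2 * 3)}
    (hα : IsSpinorIso e₂ e₃ α) (ε : ℤˣ) (x : GSM) :
    (colorOp ε).toLinearEquiv.conj (colorRep (beta x)) = dirac e₃ (α (beta x)).2 := by
  obtain ⟨-, h⟩ := (isSpinorIso_iff e₂ e₃ α).mp hα (beta x)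
  rw [colorRep_eq, conj_matrixRep_eq_dirac_iff]
  -- The entry -ε compares w̄ ↦ ε with w̄ ↦ -1 in `colorBasis`; all other basis vectors agree.
  let s : Color ⊕ Color → ℂ := Sum.elim (fun _ => 1) (Sum.elim (fun _ => 1) fun _ => -(ε : ℤ))
  have hs : ∀ i, ((EuclideanSpace.basisFun (Color ⊕ Color) ℂ).map (colorOp ε)) i = s i • colorBasis i := by
    intro i
    rw [colorBasis_apply, OrthonormalBasis.map_apply, EuclideanSpace.basisFun_apply, colorOp,
      unitaryOfFamily_single]
    rcases i with (i | i) | (i | i)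
    · simp [s, colorCode]
    · simp [s, colorCode]
    · fin_cases i <;> simp [s, colorCode]
    · simp [s, colorCode]
  have hc : ∀ i j, colorHom (beta x) i j * s i = s j * colorHom (beta x) i j := by
    intro i j
    rw [colorHom_beta]
    rcases i with (i | i) | (i | i) <;> rcases j with (j | j) | (j | j) <;> simp [s, mul_comm]
  refine cliffMatrix_eq_of_basis ((EuclideanSpace.basisFun (Color ⊕ Color) ℂ).map (colorOp ε)) e₃ fun j => ?_
  rw [hs, map_smul, cliffAction_basis, Finset.smul_sum]
  refine Finset.sum_congr rfl fun i _ => ?_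
  have h' : cliffMatrix colorBasis e₃ (α (beta x)).2.1 i j = colorHom (beta x) i j :=
    congrFun (congrFun h i) j
  refine (congrArg (fun z : ℂ => s j • z • colorBasis i) h').trans ?_
  rw [hs, smul_smul, smul_smul, hc]

theorem hOp_conj_smRep {e₂ : Fin (2 * 2) ≃ Fin 2 ⊕ Fin 2} {e₃ : Fin (2 * 3) ≃ Fin 3 ⊕ Fin 3}
    {α : PSGroup ≃ₜ* Spin (2 * 2) × Spin (2 * 3)} (hα : IsSpinorIso e₂ e₃ α) (ε : ℤˣ) (x : GSM) :
    (hOp ε).toLinearEquiv.conj (smRep x) = diracTensor e₂ e₃ (theta α x) := by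
  have h : (hOp ε).toLinearEquiv.conj (smRep x) =
      (kOp ε).toLinearEquiv.conj (ellOp.toLinearEquiv.conj (smRep x)) := rfl
  obtain ⟨h1, -⟩ := (isSpinorIso_iff e₂ e₃ α).mp hα (beta x)
  rw [h, ellOp_conj_smRep, kOp_conj_psRep, colorOp_conj_colorRep_beta hα, isospinRep_eq,
    (conj_matrixRep_eq_dirac_iff isospinOp isospinHom (beta x) e₂ (α (beta x)).1).mpr h1]
  rfl

theorem continuous_beta : Continuous beta := by
  have h1 : Continuous fun x : GSM => (x.1 : ℂ) := continuous_subtype_val.comp continuous_fst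
  have hz : ∀ m : ℤ, Continuous fun x : GSM => (x.1 : ℂ) ^ m := fun m =>
    h1.zpow₀ m fun x => Or.inl (Circle.coe_ne_zero x.1)
  have h3 : Continuous fun x : GSM => x.2.2.1 :=
    continuous_subtype_val.comp (continuous_snd.comp continuous_snd)
  refine Continuous.prodMk (continuous_fst.comp continuous_snd)
    (Continuous.prodMk (Continuous.subtype_mk ?_ _) (Continuous.subtype_mk ?_ _))
  · refine Continuous.matrix_diagonal (continuous_pi fun i => ?_)
    fin_cases i
    · exact hz 3
    · exact hz (-3)
  · refine Continuous.matrix_fromBlocks ?_ continuous_const continuous_const ?_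
    · exact h1.smul h3
    · exact Continuous.matrix_diagonal (continuous_pi fun _ => hz (-3))

end PatiSalam

theorem theorem5 (e₂ : Fin (2 * 2) ≃ Fin 2 ⊕ Fin 2) (e₃ : Fin (2 * 3) ≃ Fin 3 ⊕ Fin 3) :
    -- the three representations are unitary
    (∀ x, smRep x ∈ unitary (SMSpace →ₗ[ℂ] SMSpace)) ∧
    (∀ x, psRep x ∈ unitary (PSSpace →ₗ[ℂ] PSSpace)) ∧
    (∀ s, diracTensor e₂ e₃ s ∈ unitary (ExtAlg 2 ⊗[ℂ] ExtAlg 3 →ₗ[ℂ] ExtAlg 2 ⊗[ℂ] ExtAlg 3)) ∧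
    -- the three chosen unitary operators determine an isomorphism `α`
    (∃! α : PSGroup ≃ₜ* Spin (2 * 2) × Spin (2 * 3), IsSpinorIso e₂ e₃ α) ∧
    ∀ α : PSGroup ≃ₜ* Spin (2 * 2) × Spin (2 * 3), IsSpinorIso e₂ e₃ α →
      -- `α` and `k` intertwine the Pati-Salam representation with the spinors
      (∀ x, (kOp (-1)).toLinearEquiv.conj (psRep x) = diracTensor e₂ e₃ (α x)) ∧
      -- the square for `θ = α β` and `h = k ℓ` commutes
      Continuous (theta α) ∧
      ∀ (ε : ℤˣ) (x : GSM),
        (hOp ε).toLinearEquiv.conj (smRep x) = diracTensor e₂ e₃ (theta α x) := by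
  refine ⟨matrixRep_mem_unitary (withDual_inv fermionHom_inv), fun x => ?_, fun s => ?_,
    existsUnique_isSpinorIso e₂ e₃, fun α hα => ⟨kOp_neg_one_conj_psRep hα, ?_,
      hOp_conj_smRep hα⟩⟩
  · exact tensorProduct_map_mem_unitary (matrixRep_mem_unitary isospinHom_inv x)
      (matrixRep_mem_unitary colorHom_inv x)
  · exact tensorProduct_map_mem_unitary (dirac_mem_unitary e₂ s.1) (dirac_mem_unitary e₃ s.2)
  · exact α.continuous.comp continuous_beta
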